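/- **Setting.** Let $d\ge 1$ and let $\mu$ be the uniform measure on $\{0,1\}^d$, with the coordinatewise order. One observes $n$ independent pairs $(X_j,Y_j)$, $Y_j=f(X_j)+\varepsilon_j$, $1\le j\le n$, where $X_1,\dots,X_n$ are i.i.d. of law $\mu$, and $\varepsilon_1,\dots,\varepsilon_n$ are independent, independent of the $X_j$, centered, and satisfy $\mathbb E[e^{t\varepsilon_j}]\le e^{\sigma^2t^2/2}$ for all $t\in\mathbb R$, with $\sigma>0$. An estimator is a measurable function $\hat f$ of the sample $\mathcal D_n$ with values in the functions $\{0,1\}^d\to\mathbb R$; its risk is $R(\hat f,f)=\mathbb E\|\hat f-f\|_2^2$, where $\|g\|_2^2=2^{-d}\sum_x g(x)^2$. For $f:\{0,1\}^d\to\mathbb R$ put $\Delta_if(x)=f(x^{i\to1})-f(x^{i\to0})$, where $x^{i\to b}$ is $x$ with its $i$-th coordinate replaced by $b$, and $I(f)=\sum_i\mathbb E_\mu|\Delta_if|$, $I^{(2)}(f)=\sum_i\mathbb E_\mu(\Delta_if)^2$. Let $\mathcal F_K$ be the set of coordinatewise nondecreasing $f:\{0,1\}^d\to[0,1]$ with $I(f)\le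 K$, and $\mathcal F_{K,B}=\{f\in\mathcal F_K: I^{(2)}(f)\le B\}$. **The estimator $\hat f_n$**, with input constants $\gamma>2\log3$ and $c_0>0$. Let $n_1=\lfloor n/2\rfloor$, $n_2=n-n_1$, $\chi_S(x)=\prod_{i\in S}(2x_i-1)$, $$d_0=\max\Bigl(\Bigl\lceil\sqrt{(\log n-c_0\sqrt{\log n})_+/\gamma}\,\Bigr\rceil,1\Bigr),\qquad \delta=e^{-\gamma d_0}.$$ From the first $n_1$ observations compute $\hat I_i=\bar Y_{i,1}-\bar Y_{i,0}$, where $\bar Y_{i,b}$ is the average of the $Y_j$, $j\le n_1$, with $X_{j,i}=b$ (zero if there are none), and $\hat J=\{i:\hat I_i\ge\delta/2\}$. From the other observations compute $\tilde f(S)=n_2^{-1}\sum_{j>n_1}Y_j\chi_S(X_j)$, and set $$\hat f_n(x)=\max\Bigl(0,\min\Bigl(\sum_{S\subseteq\hat J,\ |S|\le d_0}\tilde f(S)\chi_S(x),\,1\Bigr)\Bigr).$$ **Theorem.** Fix $\gamma>2\log 3$, and fix $c_0$ larger than a suitable constant depending only on $\gamma$. For every $\sigma>0$ and $\varepsilon\in(0,1)$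 there are constants $c,C>0$ (depending only on $\sigma$, $\varepsilon$ and the fixed $\gamma,c_0$) such that the following holds for all integers $n\ge2$, $d\ge1$ and all noise laws as above. (i) If $\log d\le n^{1-\varepsilon}$, then the estimator $\hat f_n$, which does not depend on $K$ or $B$, satisfies, for all $1\le K\le\sqrt{\log n}$ and $1\le B\le K$, $$\sup_{f\in\mathcal F_{K,B}}R(\hat f_n,f)\le C\,\frac{B}{\sqrt{\log n}}.$$ (ii) For all $0<K\le c\sqrt{\log n}$ and $0<B\le K^2/\sqrt{\log n}$, if $d\ge(1/c)\log n$, then $$\inf_{\tilde f}\ \sup_{f\in\mathcal F_{K,B}}R(\tilde f,f)\ge c\,\frac{B}{\log n},$$ where the infimum is over all estimators $\tilde f=\tilde f(\mathcal D_n)$. -/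

import Mathlib

open MeasureTheory
open scoped ENNReal

noncomputable section

namespace CubeRegression

/-- The Boolean hypercube `{0,1}^d`, with the coordinatewise order. -/
abbrev Cube (d : ℕ) : Type := Fin d → Bool

/-- The mean of `g` under the uniform measure on the hypercube. -/
def cubeMean {d : ℕ} (g : Cube d → ℝ) : ℝ := (∑ x : Cube d, g x) / 2 ^ d

/-- The squared norm of `g` in `L²` of the uniform measure. -/
def sqNorm {d : ℕ} (g : Cube d → ℝ) : ℝ := cubeMean fun x => g x ^ 2

/-- The discrete derivative of `f` in direction `i`. -/
def discreteDeriv {d : ℕ} (f : Cube d → ℝ) (i : Fin d) (x : Cube d) : ℝ :=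
  f (Function.update x i true) - f (Function.update x i false)

/-- The `L¹`-influence of coordinate `i` on `f`. -/
def influence {d : ℕ} (f : Cube d → ℝ) (i : Fin d) : ℝ :=
  cubeMean fun x => |discreteDeriv f i x|

/-- The total `L¹`-influence `I(f)`. -/
def totalInfluence {d : ℕ} (f : Cube d → ℝ) : ℝ := ∑ i : Fin d, influence f i

/-- The `L²`-influence of coordinate `i` on `f`. -/
def influenceTwo {d : ℕ} (f : Cube d → ℝ) (i : Fin d) : ℝ :=
  cubeMean fun x => discreteDeriv f i x ^ 2

/-- The total `L²`-influence `I⁽²⁾(f)`. -/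
def totalInfluenceTwo {d : ℕ} (f : Cube d → ℝ) : ℝ := ∑ i : Fin d, influenceTwo f i

/-- The class `M_d` of monotone functions from the hypercube to `[0,1]`. -/
def monotoneClass (d : ℕ) : Set (Cube d → ℝ) :=
  {f | Monotone f ∧ ∀ x, f x ∈ Set.Icc (0 : ℝ) 1}

/-- The class `F_K`: monotone functions to `[0,1]` with total `L¹`-influence at most `K`. -/
def influenceClass (d : ℕ) (K : ℝ) : Set (Cube d → ℝ) :=
  {f | f ∈ monotoneClass d ∧ totalInfluence f ≤ K}

/-- The sub-class `F_{K,B}` of functions in `F_K` with total `L²`-influence at most `B`. -/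
def influenceSubclass (d : ℕ) (K B : ℝ) : Set (Cube d → ℝ) :=
  {f | f ∈ influenceClass d K ∧ totalInfluenceTwo f ≤ B}

/-- The uniform probability measure on the hypercube. -/
def cubeMeasure (d : ℕ) : Measure (Cube d) := ProbabilityTheory.uniformOn Set.univ

/-- `ν` is the law of a centered noise variable that is sub-Gaussian with parameter `σ²`. -/
structure IsNoiseLaw (σ : ℝ) (ν : Measure ℝ) : Prop where
  isProbabilityMeasure : IsProbabilityMeasure ν
  centered : Integrable (fun e : ℝ => e) ν ∧ ∫ e, e ∂ν = 0
  subGaussian : ∀ t : ℝ, Integrable (fun e => Real.exp (t * e)) ν ∧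
    ∫ e, Real.exp (t * e) ∂ν ≤ Real.exp (σ ^ 2 * t ^ 2 / 2)

/-- A sample `(X_j, Y_j)`, `j = 0, …, n - 1`. -/
abbrev Sample (n d : ℕ) : Type := Fin n → Cube d × ℝ

/-- The law of the sample: the pairs `(X_j, f(X_j) + ε_j)` are independent, `X_j` is uniform on
the hypercube, and `ε_j` has law `ν j` and is independent of `X_j`. -/
def sampleLaw {n d : ℕ} (f : Cube d → ℝ) (ν : Fin n → Measure ℝ) : Measure (Sample n d) :=
  Measure.pi fun j =>
    ((cubeMeasure d).prod (ν j)).map fun p : Cube d × ℝ => (p.1, f p.1 + p.2)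

/-- The integrated squared risk `E ‖f̂ - f‖²` of an estimator under noise laws `ν`; it may be
infinite. -/
def risk {n d : ℕ} (ν : Fin n → Measure ℝ) (fhat : Sample n d → Cube d → ℝ)
    (f : Cube d → ℝ) : ℝ≥0∞ :=
  ∫⁻ D, ENNReal.ofReal (sqNorm fun x => fhat D x - f x) ∂(sampleLaw f ν)

/-- The character `χ_S(x) = ∏_{i ∈ S} (2 x_i - 1)`. -/
def character {d : ℕ} (S : Finset (Fin d)) (x : Cube d) : ℝ :=
  ∏ i ∈ S, if x i then (1 : ℝ) else -1

/-- The degree cut-off `d₀` of the Fourier thresholding estimator. -/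
def degreeCutoff (γ c₀ : ℝ) (n : ℕ) : ℕ :=
  max ⌈Real.sqrt (max (Real.log n - c₀ * Real.sqrt (Real.log n)) 0 / γ)⌉₊ 1

/-- The influence threshold `δ = exp(-γ d₀)`. -/
def influenceThreshold (γ c₀ : ℝ) (n : ℕ) : ℝ := Real.exp (-γ * degreeCutoff γ c₀ n)

/-- The indices `j` in the first half of the sample with `X_{j,i} = b`. -/
def firstHalfIndices {n d : ℕ} (D : Sample n d) (i : Fin d) (b : Bool) : Finset (Fin n) :=
  {j : Fin n | j.val < n / 2 ∧ (D j).1 i = b}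

/-- The mean of the responses in the first half of the sample with `X_{j,i} = b` (zero if there
are none). -/
def conditionalMean {n d : ℕ} (D : Sample n d) (i : Fin d) (b : Bool) : ℝ :=
  (∑ j ∈ firstHalfIndices D i b, (D j).2) / ((firstHalfIndices D i b).card : ℝ)

/-- The estimated `L¹`-influence of coordinate `i`. -/
def estimatedInfluence {n d : ℕ} (D : Sample n d) (i : Fin d) : ℝ :=
  conditionalMean D i true - conditionalMean D i false

open Classical in
/-- The set of selected coordinates. -/
def selectedCoords {n d : ℕ} (γ c₀ : ℝ) (D : Sample n d) : Finset (Fin d) :=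
  {i : Fin d | influenceThreshold γ c₀ n / 2 ≤ estimatedInfluence D i}

/-- The empirical Fourier coefficient at `S`, computed from the second half of the sample. -/
def empiricalCoeff {n d : ℕ} (D : Sample n d) (S : Finset (Fin d)) : ℝ :=
  (∑ j : Fin n with n / 2 ≤ j.val, (D j).2 * character S (D j).1) / ((n - n / 2 : ℕ) : ℝ)

/-- The Fourier thresholding estimator `f̂_n`, with input constants `γ` and `c₀`. -/
def fourierEstimator {n d : ℕ} (γ c₀ : ℝ) (D : Sample n d) (x : Cube d) : ℝ :=
  max 0 (min
    (∑ S ∈ (selectedCoords γ c₀ D).powerset with S.card ≤ degreeCutoff γ c₀ n,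
      empiricalCoeff D S * character S x) 1)

end CubeRegression

end

open CubeRegression

/-! Upper bound. The sample is split so that the selected set `J` is independent of the empirical
Fourier coefficients. Outside a rare event every estimated influence is within `δ/4` of the true
one; then `J` contains every coordinate of influence above `δ`, and `δ * |J| ≤ 4K`. By Parseval the
error splits into four terms. Sets of size above `k = d₀`: the identity `∑ |S| f̂(S)² = I⁽²⁾(f)/4`
bounds their weight by `B/(4k)`, the leading term. Small sets meeting the complement of `J`:
hypercontractivity (`low_degree_weight_le`) gives at most `3^k √δ K`, exponentially small in `k`
because `γ > 2 log 3`. Variance: at most `δ^{-k} e^{4K}` coefficients are estimated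
(`card_smallSubsets_le`), each with variance `O(1/n)`; the correction `c₀ √(log n)` in `d₀` makes
the product `O(1/√(log n))`. The rare event: clipping caps the loss at 1, and its probability is at
most `6d exp(-c n δ²)`. Since `δ = exp(-O(√(log n)))` decays more slowly than any power of `n`, this
beats `log d ≤ n^{1-ε}`.

Lower bound. Fix `2k` coordinates with `4^k ≥ 2n` and `k` of order `log n`. They cut the cube into
cells, each unseen by the design with probability at least 1/2. Take `a` times majority on these
coordinates, with arbitrary values 0 or `a` on the middle-layer cells. On an unseen cell the data
cannot distinguish the two values, so the squared error averages at least `a²/4`. The middle layer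
has mass of order `1/√k`, and monotone functions of `m` coordinates have total influence at most
`√m`, which permits `a²` of order `B/√(log n)` (`le_sum_sqNorm`, `totalInfluence_le_sqrt_card`). The
noise plays no part here. -/

noncomputable section

namespace CubeRegression

/-! ### Averages over the cube. -/

section Mean

variable {d : ℕ}

lemma cubeMean_add (f g : Cube d → ℝ) :
    cubeMean (fun x => f x + g x) = cubeMean f + cubeMean g := by
  simp only [cubeMean, Finset.sum_add_distrib, add_div]

lemma cubeMean_sub (f g : Cube d → ℝ) :
    cubeMean (fun x => f x - g x) = cubeMean f - cubeMean g := by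
  simp only [cubeMean, Finset.sum_sub_distrib, sub_div]

lemma cubeMean_const_mul (c : ℝ) (f : Cube d → ℝ) :
    cubeMean (fun x => c * f x) = c * cubeMean f := by
  simp only [cubeMean, ← Finset.mul_sum, mul_div_assoc]

lemma cubeMean_neg (f : Cube d → ℝ) : cubeMean (fun x => -f x) = -cubeMean f := by
  simp only [cubeMean, Finset.sum_neg_distrib, neg_div]

lemma cubeMean_sum {ι : Type*} (s : Finset ι) (f : ι → Cube d → ℝ) :
    cubeMean (fun x => ∑ a ∈ s, f a x) = ∑ a ∈ s, cubeMean (f a) := by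
  simp only [cubeMean]
  rw [Finset.sum_comm, Finset.sum_div]

lemma cubeMean_mono {f g : Cube d → ℝ} (h : ∀ x, f x ≤ g x) : cubeMean f ≤ cubeMean g := by
  unfold cubeMean
  gcongr with x
  exact h x

lemma cubeMean_const (c : ℝ) : cubeMean (fun _ : Cube d => c) = c := by
  simp [cubeMean]

lemma cubeMean_nonneg {f : Cube d → ℝ} (h : ∀ x, 0 ≤ f x) : 0 ≤ cubeMean f := by
  simpa [cubeMean_const] using cubeMean_mono (f := fun _ => 0) h

lemma sqNorm_nonneg (f : Cube d → ℝ) : 0 ≤ sqNorm f := cubeMean_nonneg fun x => sq_nonneg (f x)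

lemma cubeMean_mul_sq_le (f g : Cube d → ℝ) :
    cubeMean (fun x => f x * g x) ^ 2 ≤
      cubeMean (fun x => f x ^ 2) * cubeMean (fun x => g x ^ 2) := by
  simp only [cubeMean]
  rw [div_pow, div_mul_div_comm, ← sq]
  gcongr
  exact Finset.sum_mul_sq_le_sq_mul_sq _ _ _

lemma abs_cubeMean_le (f : Cube d → ℝ) : |cubeMean f| ≤ cubeMean fun x => |f x| := by
  unfold cubeMean
  rw [abs_div, abs_of_pos (a := (2 : ℝ) ^ d) (by positivity)]
  gcongr
  exact Finset.abs_sum_le_sum_abs _ _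

end Mean

/-! ### Coordinate flips and characters. -/

section Flip

variable {d : ℕ}

/-- The cube point with its `i`-th coordinate switched. -/
def flip (i : Fin d) (x : Cube d) : Cube d := Function.update x i (!x i)

lemma flip_flip (i : Fin d) (x : Cube d) : flip i (flip i x) = x := by
  simp [flip]

lemma cubeMean_flip (i : Fin d) (f : Cube d → ℝ) :
    cubeMean (fun x => f (flip i x)) = cubeMean f := by
  unfold cubeMean
  congr 1
  exact Equiv.sum_comp (Function.Involutive.toPerm (flip i) (flip_flip i)) f

lemma character_flip (S : Finset (Fin d)) (i : Fin d) (x : Cube d) :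
    character S (flip i x) = if i ∈ S then -character S x else character S x := by
  unfold character
  have key : ∀ T : Finset (Fin d), i ∉ T →
      (∏ j ∈ T, if flip i x j then (1 : ℝ) else -1) = ∏ j ∈ T, if x j then (1 : ℝ) else -1 := by
    intro T hT
    refine Finset.prod_congr rfl fun j hj => ?_
    have : j ≠ i := fun h => hT (h ▸ hj)
    simp [flip, this]
  split_ifs with h
  · rw [← Finset.mul_prod_erase _ _ h, ← Finset.mul_prod_erase (a := i) _ _ h,
      key _ (Finset.notMem_erase i S)]
    cases hx : x i <;> simp [flip, hx]
  · exact key S h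

lemma character_mul_self (S : Finset (Fin d)) (x : Cube d) :
    character S x * character S x = 1 := by
  unfold character
  rw [← Finset.prod_mul_distrib]
  exact Finset.prod_eq_one fun i _ => by split_ifs <;> norm_num

lemma character_sq (S : Finset (Fin d)) (x : Cube d) : character S x ^ 2 = 1 := by
  rw [sq, character_mul_self]

lemma abs_character (S : Finset (Fin d)) (x : Cube d) : |character S x| = 1 := by
  exact (sq_eq_sq_iff_abs_eq_abs _ _).1 (by rw [character_sq, one_pow]) |>.trans abs_one

lemma character_insert {S : Finset (Fin d)} {i : Fin d} (h : i ∉ S) (x : Cube d) :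
    character (insert i S) x = character {i} x * character S x := by
  simp [character, Finset.prod_insert h]

end Flip

/-! ### Fourier analysis: Parseval, hypercontractivity, bias of low-degree projections. -/

section Fourier

variable {d : ℕ}

lemma cubeMean_character_mul (S T : Finset (Fin d)) :
    cubeMean (fun x => character S x * character T x) = if S = T then 1 else 0 := by
  split_ifs with h
  · subst h
    simp [character_mul_self, cubeMean_const]
  · obtain ⟨i, hi⟩ : ∃ i, ¬(i ∈ S ↔ i ∈ T) := by
      -- Flipping a coordinate that lies in exactly one of the two sets changes the sign of the
      -- product, so its mean vanishes.
      by_contra! hc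
      exact h (Finset.ext hc)
    have h1 := cubeMean_flip i (fun x => character S x * character T x)
    simp only [character_flip] at h1
    by_cases hS : i ∈ S <;> by_cases hT : i ∈ T <;> simp [hS, hT] at hi h1
    all_goals
      rw [cubeMean_neg] at h1
      linarith

lemma sum_character_mul (x y : Cube d) :
    ∑ S : Finset (Fin d), character S x * character S y = if x = y then 2 ^ d else 0 := by
  split_ifs with h
  · subst h
    simp [character_mul_self]
  · obtain ⟨i, hi⟩ := Function.ne_iff.mp h
    -- The sum over `S` factors as `∏ (1 + x_i y_i)` in `±1` notation; a coordinate where `x` and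
    -- `y` differ contributes a zero factor.
    have := Finset.prod_one_add (s := (Finset.univ : Finset (Fin d)))
      (f := fun i => (if x i then (1 : ℝ) else -1) * (if y i then (1 : ℝ) else -1))
    simp only [Finset.powerset_univ, Finset.prod_mul_distrib] at this
    unfold character
    rw [← this]
    refine Finset.prod_eq_zero (Finset.mem_univ i) ?_
    cases hx : x i <;> cases hy : y i <;> simp_all

/-- The Fourier coefficient of `f` at `S`. -/
def fourierCoeff (f : Cube d → ℝ) (S : Finset (Fin d)) : ℝ :=
  cubeMean fun x => f x * character S x

lemma fourier_expansion (f : Cube d → ℝ) (x : Cube d) :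
    ∑ S : Finset (Fin d), fourierCoeff f S * character S x = f x := by
  simp only [fourierCoeff, cubeMean, div_mul_eq_mul_div, Finset.sum_mul]
  rw [← Finset.sum_div, Finset.sum_comm]
  have : ∀ y, ∑ S : Finset (Fin d), f y * character S y * character S x =
      f y * if y = x then 2 ^ d else 0 := by
    intro y
    rw [← sum_character_mul, Finset.mul_sum]
    exact Finset.sum_congr rfl fun _ _ => by ring
  simp [this]

lemma cubeMean_mul_expansion (f : Cube d → ℝ) (s : Finset (Finset (Fin d)))
    (a : Finset (Fin d) → ℝ) :
    cubeMean (fun x => f x * ∑ S ∈ s, a S * character S x) = ∑ S ∈ s, a S * fourierCoeff f S := by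
  simp only [Finset.mul_sum]
  rw [cubeMean_sum]
  refine Finset.sum_congr rfl fun S _ => ?_
  rw [fourierCoeff, ← cubeMean_const_mul]
  congr 1; ext x; ring

lemma fourierCoeff_expansion (s : Finset (Finset (Fin d))) (a : Finset (Fin d) → ℝ)
    (T : Finset (Fin d)) :
    fourierCoeff (fun x => ∑ S ∈ s, a S * character S x) T = if T ∈ s then a T else 0 := by
  have := cubeMean_mul_expansion (character T) s a
  simp only [fourierCoeff, cubeMean_character_mul] at this ⊢
  simp only [mul_comm (character T _)] at this
  rw [this]
  simp

lemma sqNorm_expansion (s : Finset (Finset (Fin d))) (a : Finset (Fin d) → ℝ) :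
    sqNorm (fun x => ∑ S ∈ s, a S * character S x) = ∑ S ∈ s, a S ^ 2 := by
  simp only [sqNorm, sq (∑ S ∈ s, _)]
  rw [cubeMean_mul_expansion]
  refine Finset.sum_congr rfl fun S hS => ?_
  rw [fourierCoeff_expansion, if_pos hS, sq]

lemma parseval (f : Cube d → ℝ) : sqNorm f = ∑ S : Finset (Fin d), fourierCoeff f S ^ 2 := by
  rw [← sqNorm_expansion]
  congr 1; ext x
  exact (fourier_expansion f x).symm

/-- The part of `f` that depends on coordinate `i`. -/
def laplacian (f : Cube d → ℝ) (i : Fin d) (x : Cube d) : ℝ := (f x - f (flip i x)) / 2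

lemma fourierCoeff_laplacian (f : Cube d → ℝ) (i : Fin d) (S : Finset (Fin d)) :
    fourierCoeff (laplacian f i) S = if i ∈ S then fourierCoeff f S else 0 := by
  have h1 : cubeMean (fun x => f (flip i x) * character S x) =
      cubeMean (fun x => f x * character S (flip i x)) := by
    rw [← cubeMean_flip i]
    simp only [flip_flip]
  have h2 : fourierCoeff (laplacian f i) S =
      (fourierCoeff f S - cubeMean (fun x => f (flip i x) * character S x)) / 2 := by
    rw [fourierCoeff, fourierCoeff, ← cubeMean_sub, div_eq_inv_mul, ← cubeMean_const_mul]
    congr 1; ext x; simp only [laplacian]; ring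
  rw [h2, h1]
  simp only [character_flip]
  split_ifs with h
  · simp only [mul_neg, cubeMean_neg, fourierCoeff]; ring
  · simp only [fourierCoeff]; ring

lemma abs_laplacian (f : Cube d → ℝ) (i : Fin d) (x : Cube d) :
    |laplacian f i x| = |discreteDeriv f i x| / 2 := by
  unfold laplacian discreteDeriv flip
  rw [abs_div, abs_two]
  congr 1
  have hx := Function.update_eq_self i x
  cases h : x i <;> rw [h] at hx <;> simp [hx, abs_sub_comm]

lemma sqNorm_laplacian (f : Cube d → ℝ) (i : Fin d) :
    sqNorm (laplacian f i) = influenceTwo f i / 4 := by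
  rw [influenceTwo, sqNorm, div_eq_inv_mul, ← cubeMean_const_mul]
  congr 1; ext x
  rw [← sq_abs, abs_laplacian, div_pow, sq_abs]; ring

/-- Each `S` is counted once for every `i ∈ S` by the Laplacians. This identity is how the budget on
`I⁽²⁾` controls the high-degree weight. -/
lemma sum_card_mul_fourierCoeff_sq (f : Cube d → ℝ) :
    ∑ S : Finset (Fin d), (S.card : ℝ) * fourierCoeff f S ^ 2 = totalInfluenceTwo f / 4 := by
  have h : ∀ S : Finset (Fin d), (S.card : ℝ) * fourierCoeff f S ^ 2 =
      ∑ i : Fin d, fourierCoeff (laplacian f i) S ^ 2 := by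
    intro S
    simp only [fourierCoeff_laplacian, ite_pow]
    simp
  simp only [h]
  rw [Finset.sum_comm, totalInfluenceTwo, Finset.sum_div]
  exact Finset.sum_congr rfl fun i _ => by rw [← parseval, sqNorm_laplacian]

/-- The Bonami inequality for the fourth moment. -/
lemma cubeMean_pow_four_le (s : Finset (Fin d)) (a : Finset (Fin d) → ℝ) :
    cubeMean (fun x => (∑ S ∈ s.powerset, a S * character S x) ^ 4) ≤
      (∑ S ∈ s.powerset, 3 ^ S.card * a S ^ 2) ^ 2 := by
  induction s using Finset.induction_on generalizing a with
  | empty => simp [character, cubeMean_const, ← pow_mul]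
  | insert i s hi ih =>
    have hmem : ∀ S ∈ s.powerset, i ∉ S := fun S hS h => hi (Finset.mem_powerset.mp hS h)
    set Q : Cube d → ℝ := fun x => ∑ S ∈ s.powerset, a S * character S x with hQ
    set R : Cube d → ℝ := fun x => ∑ S ∈ s.powerset, a (insert i S) * character S x with hR
    set q := ∑ S ∈ s.powerset, 3 ^ S.card * a S ^ 2 with hq
    set r := ∑ S ∈ s.powerset, 3 ^ S.card * a (insert i S) ^ 2 with hr
    have hq0 : 0 ≤ q := Finset.sum_nonneg fun _ _ => by positivity
    have hr0 : 0 ≤ r := Finset.sum_nonneg fun _ _ => by positivity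
    have hflipQ : ∀ x, Q (flip i x) = Q x := fun x => Finset.sum_congr rfl fun S hS => by
      rw [character_flip, if_neg (hmem S hS)]
    have hflipR : ∀ x, R (flip i x) = R x := fun x => Finset.sum_congr rfl fun S hS => by
      rw [character_flip, if_neg (hmem S hS)]
    have hP : ∀ x, ∑ S ∈ (insert i s).powerset, a S * character S x =
        Q x + character {i} x * R x := by
      intro x
      rw [Finset.sum_powerset_insert hi, hQ, hR]
      simp only [Finset.mul_sum]
      congr 1
      refine Finset.sum_congr rfl fun S hS => ?_
      rw [character_insert (hmem S hS)]; ring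
    have hsum : ∑ S ∈ (insert i s).powerset, 3 ^ S.card * a S ^ 2 = q + 3 * r := by
      rw [Finset.sum_powerset_insert hi, hq, hr, Finset.mul_sum]
      congr 1
      refine Finset.sum_congr rfl fun S hS => ?_
      rw [Finset.card_insert_of_notMem (hmem S hS)]; ring
    have hmean : cubeMean (fun x => (Q x + character {i} x * R x) ^ 4) =
        cubeMean (fun x => Q x ^ 4) + 6 * cubeMean (fun x => Q x ^ 2 * R x ^ 2) +
          cubeMean (fun x => R x ^ 4) := by
      -- Averaging over the flip of coordinate `i`, on which `Q` and `R` do not depend, cancels the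
      -- odd powers of `R`.
      have h1 := cubeMean_flip i (fun x => (Q x + character {i} x * R x) ^ 4)
      have h2 : cubeMean (fun x => (Q x + character {i} x * R x) ^ 4) =
          cubeMean (fun x => 2⁻¹ * ((Q x + character {i} x * R x) ^ 4 +
            (Q (flip i x) + character {i} (flip i x) * R (flip i x)) ^ 4)) := by
        rw [cubeMean_const_mul, cubeMean_add, h1]; ring
      rw [h2, ← cubeMean_const_mul, ← cubeMean_add, ← cubeMean_add]
      congr 1; ext x
      rw [hflipQ, hflipR, character_flip, if_pos (Finset.mem_singleton_self i)]
      have h3 := character_sq {i} x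
      have h4 : character {i} x ^ 4 = 1 := by rw [show 4 = 2 * 2 by rfl, pow_mul, h3, one_pow]
      linear_combination 6 * Q x ^ 2 * R x ^ 2 * h3 + R x ^ 4 * h4
    simp only [hP, hsum]
    rw [hmean]
    have hQ4 := ih a
    have hR4 := ih (fun S => a (insert i S))
    have hcs := cubeMean_mul_sq_le (fun x => Q x ^ 2) (fun x => R x ^ 2)
    simp only [← pow_mul, Nat.reduceMul] at hcs
    have hQR : cubeMean (fun x => Q x ^ 2 * R x ^ 2) ≤ q * r := by
      refine abs_le_of_sq_le_sq' (a := cubeMean _) ?_ (mul_nonneg hq0 hr0) |>.2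
      refine hcs.trans ?_
      rw [mul_pow]
      exact mul_le_mul hQ4 hR4 (cubeMean_nonneg fun x => by positivity) (by positivity)
    -- The induction closes because `q² + 6qr + r² ≤ (q + 3r)²`.
    nlinarith [mul_nonneg hq0 hr0, sq_nonneg r]

/-- Hölder with exponents 4 and 4/3, done by two applications of Cauchy–Schwarz; `|g| ≤ 1` replaces
the 4/3-norm by the mean of `|g|`. -/
lemma cubeMean_mul_pow_four_le (P g : Cube d → ℝ) (hg : ∀ x, |g x| ≤ 1) :
    cubeMean (fun x => P x * g x) ^ 4 ≤
      cubeMean (fun x => P x ^ 4) * cubeMean (fun x => |g x|) ^ 3 := by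
  set m := cubeMean (fun x => |g x|) with hm
  have hm0 : 0 ≤ m := cubeMean_nonneg fun x => abs_nonneg _
  have h1 : cubeMean (fun x => P x * g x) ^ 2 ≤ cubeMean (fun x => P x ^ 2 * |g x|) * m := by
    have := cubeMean_mul_sq_le (fun x => |P x| * Real.sqrt |g x|) (fun x => Real.sqrt |g x|)
    simp only [mul_pow, mul_assoc, Real.mul_self_sqrt (abs_nonneg _),
      Real.sq_sqrt (abs_nonneg _), sq_abs] at this
    refine le_trans ?_ this
    rw [← sq_abs]
    gcongr
    refine (abs_cubeMean_le _).trans_eq ?_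
    simp only [abs_mul]
  have h2 : cubeMean (fun x => P x ^ 2 * |g x|) ^ 2 ≤ cubeMean (fun x => P x ^ 4) * m := by
    refine (cubeMean_mul_sq_le _ _).trans ?_
    simp only [← pow_mul, Nat.reduceMul]
    gcongr
    · exact cubeMean_nonneg fun x => by positivity
    · refine cubeMean_mono fun x => ?_
      nlinarith [hg x, abs_nonneg (g x)]
  calc cubeMean (fun x => P x * g x) ^ 4 = (cubeMean (fun x => P x * g x) ^ 2) ^ 2 := by ring
    _ ≤ (cubeMean (fun x => P x ^ 2 * |g x|) * m) ^ 2 := by gcongr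
    _ = cubeMean (fun x => P x ^ 2 * |g x|) ^ 2 * m ^ 2 := by ring
    _ ≤ cubeMean (fun x => P x ^ 4) * m * m ^ 2 := by gcongr
    _ = _ := by ring

lemma influence_nonneg (f : Cube d → ℝ) (i : Fin d) : 0 ≤ influence f i :=
  cubeMean_nonneg fun _ => abs_nonneg _

lemma abs_discreteDeriv_le_one {f : Cube d → ℝ} (hf : ∀ x, f x ∈ Set.Icc (0 : ℝ) 1) (i : Fin d)
    (x : Cube d) : |discreteDeriv f i x| ≤ 1 := by
  have h1 := hf (Function.update x i true)
  have h2 := hf (Function.update x i false)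
  rw [discreteDeriv, abs_le]
  constructor <;> linarith [h1.1, h1.2, h2.1, h2.2]

/-- The low-degree Fourier weight of `f` on the sets that contain a coordinate of small influence. -/
lemma low_degree_weight_le {f : Cube d → ℝ} (hf : ∀ x, f x ∈ Set.Icc (0 : ℝ) 1) (i : Fin d) (k : ℕ)
    {δ : ℝ} (hδ : influence f i ≤ δ) :
    ∑ S : Finset (Fin d) with i ∈ S ∧ S.card ≤ k, fourierCoeff f S ^ 2 ≤
      3 ^ k * Real.sqrt δ * influence f i := by
  set W := ∑ S : Finset (Fin d) with i ∈ S ∧ S.card ≤ k, fourierCoeff f S ^ 2 with hW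
  have hW0 : 0 ≤ W := Finset.sum_nonneg fun _ _ => sq_nonneg _
  set s : Finset (Finset (Fin d)) := {S | i ∈ S ∧ S.card ≤ k} with hs
  set P : Cube d → ℝ := fun x => ∑ S ∈ s, fourierCoeff f S * character S x with hP
  have hg : ∀ x, |laplacian f i x| ≤ |discreteDeriv f i x| := fun x => by
    rw [abs_laplacian]; linarith [abs_nonneg (discreteDeriv f i x)]
  have hI := influence_nonneg f i
  -- Duality: the low-degree weight is the pairing of `P` with the Laplacian, so a fourth-moment
  -- bound on `P` and the `L¹` size of the Laplacian control it.
  have h1 : cubeMean (fun x => P x * laplacian f i x) = W := by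
    simp only [mul_comm (P _)]
    rw [hP, cubeMean_mul_expansion, hW]
    refine Finset.sum_congr rfl fun S hS => ?_
    rw [fourierCoeff_laplacian, if_pos (Finset.mem_filter.mp hS).2.1, sq]
  have h2 : cubeMean (fun x => P x ^ 4) ≤ (3 ^ k * W) ^ 2 := by
    have := cubeMean_pow_four_le Finset.univ (fun S => if S ∈ s then fourierCoeff f S else 0)
    simp only [Finset.powerset_univ, ite_mul, zero_mul, ite_pow, mul_ite, mul_zero,
      zero_pow two_ne_zero, Finset.sum_ite_mem, Finset.univ_inter] at this
    refine this.trans ?_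
    have h0 : 0 ≤ ∑ S ∈ s, 3 ^ S.card * fourierCoeff f S ^ 2 :=
      Finset.sum_nonneg fun _ _ => by positivity
    gcongr
    rw [hW, Finset.mul_sum]
    refine Finset.sum_le_sum fun S hS => ?_
    gcongr
    · norm_num
    · exact (Finset.mem_filter.mp hS).2.2
  have h3 := cubeMean_mul_pow_four_le P (laplacian f i)
    fun x => (hg x).trans (abs_discreteDeriv_le_one hf i x)
  rw [h1] at h3
  have h4 : cubeMean (fun x => |laplacian f i x|) ≤ influence f i := cubeMean_mono hg
  have h40 : 0 ≤ cubeMean (fun x => |laplacian f i x|) := cubeMean_nonneg fun x => abs_nonneg _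
  -- Dividing by `W²` leaves `W ≤ 3^k I^{3/2}` with `I` the influence of `i`; one factor `√I` is
  -- then bounded by `√δ`.
  have h5 : W ^ 4 ≤ (3 ^ k * W) ^ 2 * influence f i ^ 3 :=
    h3.trans (mul_le_mul h2 (by gcongr) (by positivity) (by positivity))
  rcases hW0.eq_or_lt with h0 | h0
  · rw [← h0]; positivity
  have h6 : W ^ 2 ≤ (3 ^ k) ^ 2 * influence f i ^ 3 := by
    have : W ^ 2 * W ^ 2 ≤ W ^ 2 * ((3 ^ k) ^ 2 * influence f i ^ 3) := by
      calc _ = W ^ 4 := by ring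
        _ ≤ _ := h5
        _ = _ := by ring
    exact le_of_mul_le_mul_left this (by positivity)
  refine abs_le_of_sq_le_sq' ?_ (by positivity) |>.2
  rw [mul_pow, mul_pow, Real.sq_sqrt (hI.trans hδ)]
  calc W ^ 2 ≤ (3 ^ k) ^ 2 * influence f i ^ 3 := h6
    _ = (3 ^ k) ^ 2 * influence f i * influence f i ^ 2 := by ring
    _ ≤ _ := by gcongr

/-- The squared bias of the projection to the degree-`k` characters supported on `J`. -/
lemma bias_le {f : Cube d → ℝ} (hf : ∀ x, f x ∈ Set.Icc (0 : ℝ) 1) (J : Finset (Fin d)) {k : ℕ}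
    (hk : 1 ≤ k) {δ : ℝ} (hJ : ∀ i, i ∉ J → influence f i ≤ δ) :
    ∑ S : Finset (Fin d) with ¬(S ⊆ J ∧ S.card ≤ k), fourierCoeff f S ^ 2 ≤
      totalInfluenceTwo f / (4 * k) + 3 ^ k * Real.sqrt δ * totalInfluence f := by
  have hk' : (0 : ℝ) < k := by exact_mod_cast hk
  -- An omitted set is either larger than `k`, so that `|S|/k ≥ 1`, or small and containing some `i
  -- ∉ J`.
  have hpt : ∀ S : Finset (Fin d), (if ¬(S ⊆ J ∧ S.card ≤ k) then fourierCoeff f S ^ 2 else 0) ≤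
      (S.card : ℝ) * fourierCoeff f S ^ 2 / k +
        ∑ i : Fin d, if i ∉ J then (if i ∈ S ∧ S.card ≤ k then fourierCoeff f S ^ 2 else 0)
          else 0 := by
    intro S
    have hA : 0 ≤ (S.card : ℝ) * fourierCoeff f S ^ 2 / k := by positivity
    have hB : ∀ i : Fin d, 0 ≤ if i ∉ J then
        (if i ∈ S ∧ S.card ≤ k then fourierCoeff f S ^ 2 else 0) else 0 := by
      intro i; split_ifs <;> positivity
    have hBs := Finset.sum_nonneg fun i (_ : i ∈ Finset.univ) => hB i
    by_cases hc : S.card ≤ k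
    · by_cases hSJ : S ⊆ J
      · rw [if_neg (by simp [hc, hSJ])]
        exact add_nonneg hA hBs
      · obtain ⟨i, hiS, hiJ⟩ := Finset.not_subset.mp hSJ
        rw [if_pos (by simp [hSJ])]
        have := Finset.single_le_sum (fun i _ => hB i) (Finset.mem_univ i)
        rw [if_pos hiJ, if_pos ⟨hiS, hc⟩] at this
        linarith
    · rw [if_pos (by simp [hc])]
      have : fourierCoeff f S ^ 2 ≤ (S.card : ℝ) * fourierCoeff f S ^ 2 / k := by
        rw [le_div_iff₀ hk', mul_comm]
        gcongr
        exact_mod_cast (not_le.mp hc).le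
      linarith
  rw [Finset.sum_filter]
  refine (Finset.sum_le_sum fun S _ => hpt S).trans ?_
  rw [Finset.sum_add_distrib, ← Finset.sum_div, sum_card_mul_fourierCoeff_sq, div_div,
    Finset.sum_comm]
  gcongr
  rw [totalInfluence, Finset.mul_sum]
  refine Finset.sum_le_sum fun i _ => ?_
  have hI := influence_nonneg f i
  by_cases hi : i ∈ J
  · simp only [hi, not_true_eq_false, if_false, Finset.sum_const_zero]
    positivity
  · simp only [hi, not_false_eq_true, if_true]
    rw [← Finset.sum_filter]
    exact low_degree_weight_le hf i k (hJ i hi)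

lemma clip_sub_sq_le {u v : ℝ} (hv : v ∈ Set.Icc (0 : ℝ) 1) :
    (max 0 (min u 1) - v) ^ 2 ≤ (u - v) ^ 2 := by
  obtain ⟨h0, h1⟩ := hv
  rw [sq_le_sq]
  rcases le_total u 1 with h | h
  · rw [min_eq_left h]
    rcases le_total 0 u with h' | h'
    · rw [max_eq_right h']
    · rw [max_eq_left h', abs_of_nonpos (by linarith), abs_of_nonpos (by linarith)]
      linarith
  · rw [min_eq_right h, max_eq_right zero_le_one, abs_of_nonneg (by linarith),
      abs_of_nonneg (by linarith)]
    linarith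

/-- Clipping to `[0,1]` cannot increase the distance to a value in `[0,1]`; orthogonality then
separates estimation error from bias. -/
lemma sqNorm_clip_sub_le {f : Cube d → ℝ} (hf : ∀ x, f x ∈ Set.Icc (0 : ℝ) 1)
    (s : Finset (Finset (Fin d))) (a : Finset (Fin d) → ℝ) :
    sqNorm (fun x => max 0 (min (∑ S ∈ s, a S * character S x) 1) - f x) ≤
      ∑ S ∈ s, (a S - fourierCoeff f S) ^ 2 + ∑ S with S ∉ s, fourierCoeff f S ^ 2 := by
  have h1 : sqNorm (fun x => max 0 (min (∑ S ∈ s, a S * character S x) 1) - f x) ≤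
      sqNorm (fun x => ∑ S ∈ s, a S * character S x - f x) :=
    cubeMean_mono fun x => clip_sub_sq_le (hf x)
  refine h1.trans_eq ?_
  have h2 : (fun x => ∑ S ∈ s, a S * character S x - f x) =
      fun x => ∑ S, ((if S ∈ s then a S else 0) - fourierCoeff f S) * character S x := by
    ext x
    simp only [sub_mul, Finset.sum_sub_distrib, fourier_expansion, ite_mul, zero_mul,
      Finset.sum_ite_mem, Finset.univ_inter]
  rw [h2, sqNorm_expansion, ← Finset.sum_filter_add_sum_filter_not _ (· ∈ s)]
  congr 1
  · simp only [Finset.filter_univ_mem]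
    exact Finset.sum_congr rfl fun S hS => by rw [if_pos hS]
  · refine Finset.sum_congr rfl fun S hS => ?_
    rw [if_neg (Finset.mem_filter.mp hS).2]; ring

lemma sqNorm_clip_sub_le_one {f : Cube d → ℝ} (hf : ∀ x, f x ∈ Set.Icc (0 : ℝ) 1)
    (u : Cube d → ℝ) : sqNorm (fun x => max 0 (min (u x) 1) - f x) ≤ 1 := by
  refine (cubeMean_mono (g := fun _ => 1) fun x => ?_).trans_eq (cubeMean_const 1)
  obtain ⟨h0, h1⟩ := hf x
  have h2 : 0 ≤ max 0 (min (u x) 1) := le_max_left _ _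
  have h3 : max 0 (min (u x) 1) ≤ 1 := max_le zero_le_one (min_le_right _ _)
  nlinarith

end Fourier

/-! ### The regression model: a common probability space and noise moments. -/

section Model

open ProbabilityTheory

variable {n d : ℕ}

instance isProbabilityMeasure_cubeMeasure : IsProbabilityMeasure (cubeMeasure d) :=
  isProbabilityMeasure_uniformOn Set.finite_univ Set.univ_nonempty

lemma cubeMeasure_real_singleton (x : Cube d) : (cubeMeasure d).real {x} = 1 / 2 ^ d := by
  simp [cubeMeasure, Measure.real, uniformOn_univ]

lemma integral_cubeMeasure (g : Cube d → ℝ) : ∫ x, g x ∂(cubeMeasure d) = cubeMean g := by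
  rw [integral_fintype .of_finite, cubeMean, Finset.sum_div]
  refine Finset.sum_congr rfl fun x _ => ?_
  rw [cubeMeasure_real_singleton, smul_eq_mul]; ring

/-- The joint law of the design points and the noise variables. -/
def designNoise (ν : Fin n → Measure ℝ) : Measure (Sample n d) :=
  Measure.pi fun j => (cubeMeasure d).prod (ν j)

/-- The sample with design points and noise `ω` and regression function `f`. -/
def observe (f : Cube d → ℝ) (ω : Sample n d) : Sample n d :=
  fun j => ((ω j).1, f (ω j).1 + (ω j).2)

lemma measurable_cube {β : Type*} [MeasurableSpace β] (f : Cube d → β) : Measurable f :=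
  measurable_of_finite f

lemma measurable_respond (f : Cube d → ℝ) :
    Measurable fun p : Cube d × ℝ => (p.1, f p.1 + p.2) :=
  measurable_fst.prodMk (((measurable_cube f).comp measurable_fst).add measurable_snd)

lemma measurable_observe (f : Cube d → ℝ) :
    Measurable (observe f : Sample n d → Sample n d) :=
  measurable_pi_lambda _ fun j => (measurable_respond f).comp (measurable_pi_apply j)

variable {ν : Fin n → Measure ℝ}

lemma isProbabilityMeasure_designNoise (hν : ∀ j, IsProbabilityMeasure (ν j)) :
    IsProbabilityMeasure (designNoise ν : Measure (Sample n d)) := by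
  unfold designNoise; infer_instance

/-- All regression functions are driven by the same design and noise. Samples for different `f` can
thus be compared pointwise in `ω`, as the lower bound requires. -/
lemma sampleLaw_eq_map (hν : ∀ j, IsProbabilityMeasure (ν j)) (f : Cube d → ℝ) :
    sampleLaw f ν = (designNoise ν).map (observe f) := by
  have : ∀ j, IsProbabilityMeasure (((cubeMeasure d).prod (ν j)).map
      fun p : Cube d × ℝ => (p.1, f p.1 + p.2)) := fun j =>
    Measure.isProbabilityMeasure_map (measurable_respond f).aemeasurable
  exact (Measure.pi_map_pi fun j => (measurable_respond f).aemeasurable).symm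

lemma measurable_sqNorm_sub {Ω : Type*} [MeasurableSpace Ω] {g : Ω → Cube d → ℝ}
    (hg : Measurable g) (f : Cube d → ℝ) :
    Measurable fun ω => ENNReal.ofReal (sqNorm fun x => g ω x - f x) := by
  unfold sqNorm cubeMean
  have : ∀ x, Measurable fun ω => g ω x := fun x => (measurable_pi_apply x).comp hg
  fun_prop

lemma risk_eq_lintegral (hν : ∀ j, IsProbabilityMeasure (ν j)) {fhat : Sample n d → Cube d → ℝ}
    (hfhat : Measurable fhat) (f : Cube d → ℝ) :
    risk ν fhat f =
      ∫⁻ ω, ENNReal.ofReal (sqNorm fun x => fhat (observe f ω) x - f x) ∂(designNoise ν) := by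
  rw [risk, sampleLaw_eq_map hν,
    lintegral_map (measurable_sqNorm_sub hfhat f) (measurable_observe f)]

variable {σ : ℝ} {τ : Measure ℝ}

lemma IsNoiseLaw.hasSubgaussianMGF (h : IsNoiseLaw σ τ) :
    HasSubgaussianMGF (fun e => e) (Real.toNNReal (σ ^ 2)) τ where
  integrable_exp_mul t := (h.subGaussian t).1
  mgf_le t := by
    rw [Real.coe_toNNReal _ (sq_nonneg σ)]
    exact (h.subGaussian t).2

lemma IsNoiseLaw.memLp (h : IsNoiseLaw σ τ) : MemLp (fun e => e) 2 τ := by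
  have := h.hasSubgaussianMGF.memLp 2
  exact_mod_cast this

lemma two_add_sq_div_two_le (x : ℝ) : 2 + x ^ 2 / 2 ≤ Real.exp x + Real.exp (-x) := by
  rcases le_total 0 x with h | h
  · linarith [Real.quadratic_le_exp_of_nonneg h, Real.add_one_le_exp (-x)]
  · have := Real.quadratic_le_exp_of_nonneg (neg_nonneg.mpr h)
    linarith [Real.add_one_le_exp x, neg_sq x]

/-- At `t = ±1/σ` each exponential moment is at most `e^{1/2} ≤ 2`, and `2 + x²/2 ≤ e^x + e^{-x}`
with `x = e/σ` turns this into a second-moment bound. The constant 4 is not optimal. -/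
lemma IsNoiseLaw.integral_sq_le (hσ : 0 < σ) (h : IsNoiseLaw σ τ) :
    ∫ e, e ^ 2 ∂τ ≤ 4 * σ ^ 2 := by
  have := h.isProbabilityMeasure
  have h1 : ∫ e, (2 + ((1 / σ) * e) ^ 2 / 2) ∂τ ≤
      ∫ e, (Real.exp ((1 / σ) * e) + Real.exp ((-1 / σ) * e)) ∂τ := by
    refine integral_mono ?_ ((h.subGaussian _).1.add (h.subGaussian _).1) fun e => ?_
    · simp only [mul_pow]
      exact (integrable_const _).add ((h.memLp.integrable_sq.const_mul _).div_const _)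
    · have := two_add_sq_div_two_le ((1 / σ) * e)
      rwa [← neg_mul, ← neg_div] at this
  rw [integral_add (h.subGaussian _).1 (h.subGaussian _).1] at h1
  simp only [mul_pow] at h1
  rw [integral_add (integrable_const _) ((h.memLp.integrable_sq.const_mul _).div_const _),
    integral_div, integral_const_mul, integral_const] at h1
  have h2 := (h.subGaussian (1 / σ)).2
  have h3 := (h.subGaussian (-1 / σ)).2
  have h4 : σ ^ 2 * (1 / σ) ^ 2 / 2 = 1 / 2 := by field_simp
  have h5 : σ ^ 2 * (-1 / σ) ^ 2 / 2 = 1 / 2 := by field_simp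
  rw [h4] at h2
  rw [h5] at h3
  have h6 : Real.exp (1 / 2) ≤ 2 := by
    refine abs_le_of_sq_le_sq' ?_ zero_le_two |>.2
    rw [← Real.exp_nat_mul]
    norm_num
    linarith [Real.exp_one_lt_d9]
  simp only [probReal_univ, smul_eq_mul, one_mul, one_div, inv_pow] at h1 h2 h3
  have h7 : (σ ^ 2)⁻¹ * ∫ e, e ^ 2 ∂τ ≤ 4 := by
    have e1 : (2 : ℝ)⁻¹ = 1 / 2 := by norm_num
    rw [e1] at h2
    linarith
  rw [inv_mul_le_iff₀ (by positivity)] at h7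
  linarith

/-- Given the design point, the noise part contributes parameter at most `σ²`; Hoeffding's lemma for
the centered `g` in `[-1,1]` contributes 1. The parameters add. -/
lemma hasSubgaussianMGF_prod (h : IsNoiseLaw σ τ) {g s : Cube d → ℝ} (hg : ∀ x, |g x| ≤ 1)
    (hg0 : cubeMean g = 0) (hs : ∀ x, |s x| ≤ 1) :
    HasSubgaussianMGF (fun p : Cube d × ℝ => g p.1 + s p.1 * p.2) (Real.toNNReal (1 + σ ^ 2))
      ((cubeMeasure d).prod τ) := by
  have := h.isProbabilityMeasure
  have hexp : ∀ (t : ℝ) (x : Cube d) (e : ℝ), Real.exp (t * (g x + s x * e)) =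
      Real.exp (t * g x) * Real.exp ((t * s x) * e) := fun t x e => by
    rw [← Real.exp_add]; ring_nf
  have hmeas : Measurable fun p : Cube d × ℝ => g p.1 + s p.1 * p.2 :=
    ((measurable_cube g).comp measurable_fst).add
      (((measurable_cube s).comp measurable_fst).mul measurable_snd)
  have hint : ∀ t : ℝ, Integrable (fun p : Cube d × ℝ => Real.exp (t * (g p.1 + s p.1 * p.2)))
      ((cubeMeasure d).prod τ) := fun t => by
    refine (integrable_prod_iff (by fun_prop)).mpr ⟨ae_of_all _ fun x => ?_, .of_finite⟩
    simp only [hexp]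
    exact (h.subGaussian _).1.const_mul _
  refine ⟨hint, fun t => ?_⟩
  have hoef : HasSubgaussianMGF g ((‖(1 : ℝ) - -1‖₊ / 2) ^ 2) (cubeMeasure d) :=
    hasSubgaussianMGF_of_mem_Icc_of_integral_eq_zero (measurable_cube g).aemeasurable
      (ae_of_all _ fun x => abs_le.mp (hg x)) (by rw [integral_cubeMeasure, hg0])
  have h1 := hoef.mgf_le t
  have h2 : ((((‖(1 : ℝ) - -1‖₊ / 2) ^ 2 : NNReal)) : ℝ) = 1 := by
    push_cast
    norm_num
  rw [h2, one_mul] at h1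
  rw [mgf, integral_prod _ (hint t), Real.coe_toNNReal _ (by positivity)]
  simp only [hexp, integral_const_mul]
  calc ∫ x, Real.exp (t * g x) * ∫ e, Real.exp (t * s x * e) ∂τ ∂(cubeMeasure d)
      ≤ ∫ x, Real.exp (t * g x) * Real.exp (σ ^ 2 * t ^ 2 / 2) ∂(cubeMeasure d) := by
        refine integral_mono .of_finite .of_finite fun x => ?_
        dsimp only
        gcongr
        refine (h.subGaussian _).2.trans ?_
        have hsx : (t * s x) ^ 2 ≤ t ^ 2 := by
          rw [mul_pow]
          refine mul_le_of_le_one_right (sq_nonneg t) ?_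
          rw [← sq_abs]
          exact pow_le_one₀ (abs_nonneg _) (hs x)
        refine Real.exp_le_exp.mpr ?_
        linarith [mul_le_mul_of_nonneg_left hsx (sq_nonneg σ)]
    _ = mgf g (cubeMeasure d) t * Real.exp (σ ^ 2 * t ^ 2 / 2) := by
        rw [integral_mul_const, mgf]
    _ ≤ Real.exp (t ^ 2 / 2) * Real.exp (σ ^ 2 * t ^ 2 / 2) := by gcongr
    _ = _ := by rw [← Real.exp_add]; ring_nf

lemma memLp_response_mul_character (h : IsNoiseLaw σ τ) (f : Cube d → ℝ) (S : Finset (Fin d)) :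
    MemLp (fun p : Cube d × ℝ => (f p.1 + p.2) * character S p.1) 2
      ((cubeMeasure d).prod τ) := by
  have := h.isProbabilityMeasure
  have hf : MemLp f 2 (cubeMeasure d) := .of_discrete
  have h1 : MemLp (fun p : Cube d × ℝ => f p.1 + p.2) 2 ((cubeMeasure d).prod τ) :=
    (hf.comp_fst τ).add (h.memLp.comp_snd (cubeMeasure d))
  refine h1.of_le ?_ (ae_of_all _ fun p => ?_)
  · exact (((measurable_respond f).snd).mul
      ((measurable_cube (character S)).comp measurable_fst)).aestronglyMeasurable
  · rw [norm_mul, Real.norm_eq_abs (character _ _), abs_character, mul_one]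

lemma integral_response_mul_character (h : IsNoiseLaw σ τ) (f : Cube d → ℝ)
    (S : Finset (Fin d)) :
    ∫ p, (f p.1 + p.2) * character S p.1 ∂((cubeMeasure d).prod τ) = fourierCoeff f S := by
  have := h.isProbabilityMeasure
  rw [integral_prod _ ((memLp_response_mul_character h f S).integrable one_le_two)]
  simp only [integral_mul_const]
  have h1 : ∀ x, ∫ e, (f x + e) ∂τ = f x := fun x => by
    rw [integral_add (integrable_const _) h.centered.1, h.centered.2]
    simp
  simp only [h1, integral_cubeMeasure, fourierCoeff]

lemma variance_response_mul_character_le (hσ : 0 < σ) (h : IsNoiseLaw σ τ) {f : Cube d → ℝ}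
    (hf : ∀ x, f x ∈ Set.Icc (0 : ℝ) 1) (S : Finset (Fin d)) :
    variance (fun p => (f p.1 + p.2) * character S p.1) ((cubeMeasure d).prod τ) ≤
      1 + 4 * σ ^ 2 := by
  have := h.isProbabilityMeasure
  have hL := memLp_response_mul_character h f S
  refine (variance_le_expectation_sq hL.1).trans ?_
  have hi := hL.integrable_sq
  simp only [mul_pow, character_sq, mul_one] at hi
  simp only [Pi.pow_apply, mul_pow, character_sq, mul_one]
  rw [integral_prod _ hi]
  have h1 : ∀ x, ∫ e, (f x + e) ^ 2 ∂τ ≤ 1 + 4 * σ ^ 2 := fun x => by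
    simp only [add_sq]
    have i1 : Integrable (fun e : ℝ => f x ^ 2 + 2 * f x * e) τ :=
      (integrable_const _).add (h.centered.1.const_mul _)
    rw [integral_add i1 h.memLp.integrable_sq,
      integral_add (integrable_const _) (h.centered.1.const_mul _), integral_const_mul,
      h.centered.2]
    have := h.integral_sq_le hσ
    have := hf x
    simp only [integral_const, probReal_univ, one_smul, mul_zero, add_zero]
    nlinarith [this.1, this.2]
  calc _ ≤ ∫ _x : Cube d, (1 + 4 * σ ^ 2) ∂(cubeMeasure d) :=
        integral_mono .of_finite .of_finite h1
    _ = _ := by simp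

end Model

/-! ### Influences of monotone functions. -/

section Monotone

variable {d : ℕ}

lemma discreteDeriv_nonneg {f : Cube d → ℝ} (hf : Monotone f) (i : Fin d) (x : Cube d) :
    0 ≤ discreteDeriv f i x := by
  refine sub_nonneg.mpr (hf fun j => ?_)
  by_cases h : j = i
  · subst h; simp
  · simp [Function.update_of_ne h]

lemma discreteDeriv_eq_laplacian (f : Cube d → ℝ) (i : Fin d) (x : Cube d) :
    discreteDeriv f i x = 2 * (laplacian f i x * character {i} x) := by
  unfold laplacian discreteDeriv flip character
  have hx := Function.update_eq_self i x
  cases h : x i <;> rw [h] at hx <;> simp [hx, h] <;> ring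

lemma influence_eq_fourierCoeff {f : Cube d → ℝ} (hf : Monotone f) (i : Fin d) :
    influence f i = 2 * fourierCoeff f {i} := by
  have h1 := fourierCoeff_laplacian f i {i}
  rw [if_pos (Finset.mem_singleton_self i)] at h1
  rw [← h1, influence, fourierCoeff, ← cubeMean_const_mul]
  congr 1; ext x
  rw [abs_of_nonneg (discreteDeriv_nonneg hf i x), discreteDeriv_eq_laplacian]

/-- For monotone `f` the total influence is twice the sum of the degree-one coefficients. Their
squares sum to at most `p - p² ≤ 1/4` by Parseval and `f² ≤ f`, where `p` is the mean;
Cauchy–Schwarz over `M` finishes. -/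
lemma totalInfluence_le_sqrt_card {f : Cube d → ℝ} (hf : f ∈ monotoneClass d)
    (M : Finset (Fin d)) (hM : ∀ i, i ∉ M → ∀ x b, f (Function.update x i b) = f x) :
    totalInfluence f ≤ Real.sqrt M.card := by
  have h1 : totalInfluence f = 2 * ∑ i ∈ M, fourierCoeff f {i} := by
    rw [totalInfluence, Finset.mul_sum,
      ← Finset.sum_subset (Finset.subset_univ M) fun i _ hi => ?_]
    · exact Finset.sum_congr rfl fun i _ => influence_eq_fourierCoeff hf.1 i
    · simp [influence, discreteDeriv, hM i hi, cubeMean_const]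
  set p := fourierCoeff f ∅ with hp
  have h2 : p ^ 2 + ∑ i ∈ M, fourierCoeff f {i} ^ 2 ≤ sqNorm f := by
    have hinj : Set.InjOn (fun i : Fin d => ({i} : Finset (Fin d))) M :=
      fun i _ j _ h => Finset.singleton_injective h
    have hni : ∅ ∉ M.image (fun i : Fin d => ({i} : Finset (Fin d))) := by simp
    rw [parseval, ← Finset.sum_image (f := fun S => fourierCoeff f S ^ 2) hinj, hp,
      ← Finset.sum_insert (f := fun S => fourierCoeff f S ^ 2) hni]
    exact Finset.sum_le_sum_of_subset_of_nonneg (Finset.subset_univ _)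
      fun _ _ _ => sq_nonneg _
  have h3 : sqNorm f ≤ p := by
    rw [hp, fourierCoeff, sqNorm]
    refine cubeMean_mono fun x => ?_
    have := hf.2 x
    simp only [character, Finset.prod_empty, mul_one]
    nlinarith [this.1, this.2]
  have h4 : (∑ i ∈ M, fourierCoeff f {i}) ^ 2 ≤ M.card * ∑ i ∈ M, fourierCoeff f {i} ^ 2 :=
    sq_sum_le_card_mul_sum_sq
  have h5 : ∑ i ∈ M, fourierCoeff f {i} ^ 2 ≤ 1 / 4 := by nlinarith [sq_nonneg (p - 1 / 2)]
  rw [h1]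
  refine Real.le_sqrt_of_sq_le ?_
  have : (0 : ℝ) ≤ M.card := Nat.cast_nonneg _
  nlinarith

lemma totalInfluenceTwo_le {f : Cube d → ℝ} (hf : ∀ x, f x ∈ Set.Icc (0 : ℝ) 1) :
    totalInfluenceTwo f ≤ totalInfluence f := by
  refine Finset.sum_le_sum fun i _ => cubeMean_mono fun x => ?_
  have := abs_discreteDeriv_le_one hf i x
  rw [← sq_abs]
  nlinarith [abs_nonneg (discreteDeriv f i x)]

lemma totalInfluence_const_mul {a : ℝ} (ha : 0 ≤ a) (f : Cube d → ℝ) :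
    totalInfluence (fun x => a * f x) = a * totalInfluence f := by
  simp only [totalInfluence, influence, discreteDeriv, ← mul_sub, abs_mul, abs_of_nonneg ha,
    cubeMean_const_mul, Finset.mul_sum]

lemma totalInfluenceTwo_const_mul (a : ℝ) (f : Cube d → ℝ) :
    totalInfluenceTwo (fun x => a * f x) = a ^ 2 * totalInfluenceTwo f := by
  simp only [totalInfluenceTwo, influenceTwo, discreteDeriv, ← mul_sub, mul_pow,
    cubeMean_const_mul, Finset.mul_sum]

end Monotone

/-! ### Majority functions with a free middle layer. -/

section Layers

variable {d : ℕ}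

/-- The coordinates in `M` that are set in `x`. -/
def trace (M : Finset (Fin d)) (x : Cube d) : Finset (Fin d) := {i ∈ M | x i = true}

/-- The majority function of the coordinates in `M`, with values on the layer of size `k`
prescribed by `θ`. -/
def layered (M : Finset (Fin d)) (k : ℕ) (θ : Finset (Fin d) → Bool) (x : Cube d) : ℝ :=
  if k < (trace M x).card ∨ ((trace M x).card = k ∧ θ (trace M x) = true) then 1 else 0

lemma trace_update {M : Finset (Fin d)} {i : Fin d} (hi : i ∉ M) (x : Cube d) (b : Bool) :
    trace M (Function.update x i b) = trace M x := by
  refine Finset.filter_congr fun j hj => ?_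
  rw [Function.update_of_ne (ne_of_mem_of_not_mem hj hi)]

/-- A layer is an antichain, so arbitrary values on it preserve monotonicity. -/
lemma layered_mem_monotoneClass (M : Finset (Fin d)) (k : ℕ) (θ : Finset (Fin d) → Bool) :
    layered M k θ ∈ monotoneClass d := by
  constructor
  · intro x y hxy
    have hsub : trace M x ⊆ trace M y := fun i hi => by
      simp only [trace, Finset.mem_filter] at hi ⊢
      exact ⟨hi.1, hxy i hi.2⟩
    unfold layered
    split_ifs with h1 h2
    · exact le_rfl
    · exfalso
      rcases hsub.eq_or_ssubset with h | h
      · rw [h] at h1; exact h2 h1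
      · have := Finset.card_lt_card h
        exact h2 (Or.inl (by omega))
    · exact zero_le_one
    · exact le_rfl
  · intro x
    unfold layered
    split_ifs <;> simp

lemma const_mul_layered_mem_influenceSubclass {M : Finset (Fin d)} {a K B : ℝ} (ha0 : 0 ≤ a)
    (ha1 : a ≤ 1) (hK : a * Real.sqrt M.card ≤ K) (hB : a ^ 2 * Real.sqrt M.card ≤ B) (k : ℕ)
    (θ : Finset (Fin d) → Bool) :
    (fun x => a * layered M k θ x) ∈ influenceSubclass d K B := by
  obtain ⟨hmono, hIcc⟩ := layered_mem_monotoneClass M k θ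
  have hI : totalInfluence (layered M k θ) ≤ Real.sqrt M.card :=
    totalInfluence_le_sqrt_card ⟨hmono, hIcc⟩ M fun i hi x b => by
      simp only [layered, trace_update hi]
  refine ⟨⟨⟨fun x y h => mul_le_mul_of_nonneg_left (hmono h) ha0, fun x => ?_⟩, ?_⟩, ?_⟩
  · exact ⟨mul_nonneg ha0 (hIcc x).1, mul_le_one₀ ha1 (hIcc x).1 (hIcc x).2⟩
  · rw [totalInfluence_const_mul ha0]
    exact (mul_le_mul_of_nonneg_left hI ha0).trans hK
  · rw [totalInfluenceTwo_const_mul]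
    exact (mul_le_mul_of_nonneg_left ((totalInfluenceTwo_le hIcc).trans hI) (sq_nonneg a)).trans hB

lemma card_trace_fiber {M A : Finset (Fin d)} (hA : A ⊆ M) :
    (Finset.univ.filter fun x : Cube d => trace M x = A).card * 2 ^ M.card = 2 ^ d := by
  have h : (Finset.univ.filter fun x : Cube d => trace M x = A) =
      Fintype.piFinset fun i : Fin d => if i ∈ M then {decide (i ∈ A)} else Finset.univ := by
    ext x
    simp only [Finset.mem_filter, Finset.mem_univ, true_and, Fintype.mem_piFinset]
    constructor
    · intro h i
      split_ifs with hi
      · subst h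
        simp [trace, hi]
      · exact Finset.mem_univ _
    · intro h
      ext i
      simp only [trace, Finset.mem_filter]
      have := h i
      by_cases hi : i ∈ M
      · simp only [hi, if_true, Finset.mem_singleton] at this
        simp [hi, this]
      · simp [hi, show i ∉ A from fun h => hi (hA h)]
  have h2 : ∀ i, (if i ∈ M then {decide (i ∈ A)} else (Finset.univ : Finset Bool)).card =
      if i ∈ M then 1 else 2 := fun i => by split_ifs <;> simp
  rw [h, Fintype.card_piFinset]
  simp only [h2]
  rw [Finset.prod_ite, Finset.prod_const_one, one_mul, Finset.prod_const, ← pow_add]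
  congr 1
  have h3 := Finset.card_filter_add_card_filter_not (s := (Finset.univ : Finset (Fin d))) (· ∈ M)
  simp only [Finset.filter_univ_mem, Finset.card_univ, Fintype.card_fin] at h3
  omega

lemma cubeMean_trace_eq {M A : Finset (Fin d)} (hA : A ⊆ M) :
    cubeMean (fun x => if trace M x = A then (1 : ℝ) else 0) = 1 / 2 ^ M.card := by
  have h := card_trace_fiber hA
  have h' : ((Finset.univ.filter fun x : Cube d => trace M x = A).card : ℝ) * 2 ^ M.card =
      2 ^ d := by exact_mod_cast h
  rw [cubeMean, Finset.sum_boole, ← h']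
  have : ((Finset.univ.filter fun x : Cube d => trace M x = A).card : ℝ) ≠ 0 := by
    intro h0; rw [h0, zero_mul] at h'
    exact absurd h'.symm (by positivity)
  field_simp

lemma cubeMean_trace_card_eq (M : Finset (Fin d)) (k : ℕ) :
    cubeMean (fun x => if (trace M x).card = k then (1 : ℝ) else 0) =
      M.card.choose k / 2 ^ M.card := by
  have h : ∀ x, (if (trace M x).card = k then (1 : ℝ) else 0) =
      ∑ A ∈ M.powersetCard k, if trace M x = A then (1 : ℝ) else 0 := fun x => by
    have hmem : trace M x ∈ M.powersetCard k ↔ (trace M x).card = k := by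
      simp [Finset.mem_powersetCard, trace]
    rw [Finset.sum_ite_eq]
    exact if_congr hmem.symm rfl rfl
  simp only [h]
  rw [cubeMean_sum, Finset.sum_congr rfl fun A hA =>
    cubeMean_trace_eq (Finset.mem_powersetCard.mp hA).1]
  simp [div_eq_mul_inv]

/-- The middle layer of the `2k`-cube has mass at least `1/(2√k)`. Squaring makes the induction
polynomial: the step is `4k(k+1) ≤ (2k+1)²`. -/
lemma four_pow_le_sqrt_mul_centralBinom {k : ℕ} (hk : 1 ≤ k) :
    (4 : ℝ) ^ k ≤ 2 * Real.sqrt k * k.centralBinom := by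
  have h : ((4 : ℝ) ^ k) ^ 2 ≤ 4 * k * (k.centralBinom : ℝ) ^ 2 := by
    induction k, hk using Nat.le_induction with
    | base => norm_num [Nat.centralBinom]
    | succ k hk ih =>
      have h1 : ((k : ℝ) + 1) * (k + 1).centralBinom = 2 * (2 * k + 1) * k.centralBinom := by
        exact_mod_cast Nat.succ_mul_centralBinom_succ k
      have h2 : (0 : ℝ) < k + 1 := by positivity
      push_cast
      rw [← mul_le_mul_iff_right₀ h2]
      calc ((k : ℝ) + 1) * (4 ^ (k + 1)) ^ 2 = 16 * (k + 1) * (4 ^ k) ^ 2 := by ring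
        _ ≤ 16 * (k + 1) * (4 * k * (k.centralBinom : ℝ) ^ 2) := by gcongr
        _ ≤ 4 * (2 * (2 * k + 1) * k.centralBinom) ^ 2 := by
          nlinarith [sq_nonneg (k.centralBinom : ℝ)]
        _ = (k + 1) * (4 * (k + 1) * ((k + 1).centralBinom : ℝ) ^ 2) := by rw [← h1]; ring
  refine abs_le_of_sq_le_sq' ?_ (by positivity) |>.2
  rw [mul_pow, mul_pow, Real.sq_sqrt (Nat.cast_nonneg k)]
  linarith

end Layers

/-! ### The minimax lower bound. -/

section LowerBound

variable {n d : ℕ} {ν : Fin n → Measure ℝ}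

lemma measurePreserving_design (hν : ∀ j, IsProbabilityMeasure (ν j)) (j : Fin n) :
    MeasurePreserving (fun ω : Sample n d => (ω j).1) (designNoise ν) (cubeMeasure d) :=
  measurePreserving_fst.comp (measurePreserving_eval _ j)

/-- No design point of `ω` has trace `A`. -/
def unseen (M A : Finset (Fin d)) (ω : Sample n d) : Prop := ∀ j, trace M (ω j).1 ≠ A

lemma measurableSet_unseen (M A : Finset (Fin d)) :
    MeasurableSet {ω : Sample n d | unseen M A ω} := by
  simp only [unseen, Set.ofPred_forall]
  exact MeasurableSet.iInter fun j => measurableSet_eq_fun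
    ((measurable_cube (trace M)).comp (measurable_fst.comp (measurable_pi_apply j)))
      measurable_const |>.compl

/-- Union bound: each of the `n` design points hits the cell with probability `2^{-|M|}`. -/
lemma half_le_unseen (hν : ∀ j, IsProbabilityMeasure (ν j)) {M A : Finset (Fin d)} (hA : A ⊆ M)
    (hn : 2 * (n : ℝ) ≤ 2 ^ M.card) :
    1 / 2 ≤ (designNoise ν).real {ω : Sample n d | unseen M A ω} := by
  have := isProbabilityMeasure_designNoise (d := d) hν
  have h2 : (designNoise ν).real {ω : Sample n d | unseen M A ω}ᶜ ≤ 1 / 2 := by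
    have hset : {ω : Sample n d | unseen M A ω}ᶜ =
        ⋃ j, (fun ω : Sample n d => (ω j).1) ⁻¹' {x | trace M x = A} := by
      ext ω; simp [unseen]
    rw [hset]
    refine (measureReal_iUnion_fintype_le _).trans ?_
    have hj : ∀ j, (designNoise ν).real ((fun ω : Sample n d => (ω j).1) ⁻¹'
        {x | trace M x = A}) = 1 / 2 ^ M.card := fun j => by
      rw [measureReal_def, (measurePreserving_design hν j).measure_preimage
        (Set.toFinite _).measurableSet.nullMeasurableSet, ← measureReal_def,
        ← cubeMean_trace_eq hA, ← integral_cubeMeasure,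
        ← integral_indicator_one (Set.toFinite _).measurableSet]
      refine integral_congr_ae (ae_of_all _ fun x => ?_)
      simp [Set.indicator]
    simp only [hj]
    rw [Finset.sum_const, Finset.card_univ, Fintype.card_fin, nsmul_eq_mul, mul_one_div,
      div_le_div_iff₀ (by positivity) two_pos]
    linarith
  rw [probReal_compl_eq_one_sub (measurableSet_unseen M A)] at h2
  linarith

/-- `θ` with its value at `A` switched. -/
def switch (A : Finset (Fin d)) (θ : Finset (Fin d) → Bool) : Finset (Fin d) → Bool :=
  Function.update θ A (!θ A)

lemma switch_switch (A : Finset (Fin d)) (θ : Finset (Fin d) → Bool) :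
    switch A (switch A θ) = θ := by
  simp [switch]

lemma layered_switch {M A : Finset (Fin d)} {k : ℕ} {θ : Finset (Fin d) → Bool} {x : Cube d}
    (h : trace M x ≠ A) : layered M k (switch A θ) x = layered M k θ x := by
  simp only [layered, switch, Function.update_of_ne h]

lemma observe_switch {M A : Finset (Fin d)} {ω : Sample n d} (h : unseen M A ω) (a : ℝ) (k : ℕ)
    (θ : Finset (Fin d) → Bool) :
    observe (fun x => a * layered M k (switch A θ) x) ω =
      observe (fun x => a * layered M k θ x) ω := by
  funext j
  simp only [observe, layered_switch (h j)]

open Classical in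
lemma le_sum_sqNorm (ftilde : Sample n d → Cube d → ℝ) (M : Finset (Fin d)) (k : ℕ) (a : ℝ)
    (ω : Sample n d) :
    (Fintype.card (Finset (Fin d) → Bool) : ℝ) * (a ^ 2 / 4 * cubeMean (fun x =>
        if (trace M x).card = k ∧ unseen M (trace M x) ω then (1 : ℝ) else 0)) ≤
      ∑ θ : Finset (Fin d) → Bool,
        sqNorm (fun x => ftilde (observe (fun x => a * layered M k θ x) ω) x -
          a * layered M k θ x) := by
  simp only [sqNorm]
  rw [← cubeMean_sum, ← cubeMean_const_mul, ← cubeMean_const_mul]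
  refine cubeMean_mono fun x => ?_
  split_ifs with h
  swap
  · rw [mul_zero, mul_zero]
    exact Finset.sum_nonneg fun _ _ => sq_nonneg _
  set A := trace M x with hA
  set q : (Finset (Fin d) → Bool) → ℝ := fun θ =>
    (ftilde (observe (fun x => a * layered M k θ x) ω) x - a * layered M k θ x) ^ 2 with hq
  have hswap : ∑ θ, q (switch A θ) = ∑ θ, q θ :=
    Equiv.sum_comp (Function.Involutive.toPerm (switch A) (switch_switch A)) q
  -- With the cell of `x` unseen, `θ` and its switch at `A` produce the same data, hence the same
  -- estimate `u`, while the targets are 0 and `a`; and `u² + (u-a)² ≥ a²/2`.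
  have hpt : ∀ θ, a ^ 2 / 2 ≤ q θ + q (switch A θ) := fun θ => by
    simp only [hq, observe_switch h.2]
    set u := ftilde (observe (fun x => a * layered M k θ x) ω) x
    have hc : trace M x = A := rfl
    cases hθ : θ A
    · simp only [layered, hc, h.1, switch, Function.update_self, hθ]
      simp
      nlinarith [sq_nonneg (2 * u - a)]
    · simp only [layered, hc, h.1, switch, Function.update_self, hθ]
      simp
      nlinarith [sq_nonneg (2 * u - a)]
  have := Finset.sum_le_sum fun θ (_ : θ ∈ Finset.univ) => hpt θ
  rw [Finset.sum_add_distrib, hswap, Finset.sum_const, nsmul_eq_mul, Finset.card_univ] at this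
  linarith

open Classical in
lemma le_iSup_risk (hν : ∀ j, IsProbabilityMeasure (ν j)) {ftilde : Sample n d → Cube d → ℝ}
    (hft : Measurable ftilde) {M : Finset (Fin d)} {k : ℕ} (hk : 1 ≤ k) (hM : M.card = 2 * k)
    (hn : 2 * (n : ℝ) ≤ 4 ^ k) {a K B : ℝ} (ha0 : 0 ≤ a)
    (ha1 : a ≤ 1) (hK : a * Real.sqrt M.card ≤ K) (hB : a ^ 2 * Real.sqrt M.card ≤ B) :
    ENNReal.ofReal (a ^ 2 / (16 * Real.sqrt k)) ≤
      ⨆ f ∈ influenceSubclass d K B, risk ν ftilde f := by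
  have := isProbabilityMeasure_designNoise (d := d) hν
  have hpow : (2 : ℝ) ^ M.card = 4 ^ k := by rw [hM, pow_mul]; norm_num
  set H : Sample n d → ℝ := fun ω => cubeMean (fun x =>
    if (trace M x).card = k ∧ unseen M (trace M x) ω then (1 : ℝ) else 0) with hH
  have hHterm : ∀ x (ω : Sample n d), (if (trace M x).card = k ∧ unseen M (trace M x) ω
      then (1 : ℝ) else 0) = (if (trace M x).card = k then (1 : ℝ) else 0) *
        Set.indicator {ω : Sample n d | unseen M (trace M x) ω} 1 ω := fun x ω => by
    by_cases h1 : (trace M x).card = k <;> by_cases h2 : unseen M (trace M x) ω <;>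
      simp [h1, h2]
  have hind : ∀ x, Integrable (fun ω => (if (trace M x).card = k then (1 : ℝ) else 0) *
      Set.indicator {ω : Sample n d | unseen M (trace M x) ω} 1 ω) (designNoise ν) := fun x =>
    ((integrable_const (1 : ℝ)).indicator (measurableSet_unseen M _)).const_mul _
  have hHint : Integrable H (designNoise ν) := by
    simp only [hH, hHterm, cubeMean]
    exact (integrable_finsetSum _ fun x _ => hind x).div_const _
  have hH0 : ∀ ω, 0 ≤ H ω := fun ω => cubeMean_nonneg fun x => by split_ifs <;> norm_num
  -- Mass at least `1/(2√k)` of the layer times probability at least 1/2 of being unseen. The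
  -- supremum over the class is then bounded below by the average over `θ`.
  have hHmean : 1 / (4 * Real.sqrt k) ≤ ∫ ω, H ω ∂(designNoise ν) := by
    have h1 : ∫ ω, H ω ∂(designNoise ν) = cubeMean (fun x =>
        (if (trace M x).card = k then (1 : ℝ) else 0) *
          (designNoise ν).real {ω : Sample n d | unseen M (trace M x) ω}) := by
      simp only [hH, hHterm, cubeMean]
      rw [integral_div, integral_finsetSum _ fun x _ => hind x]
      congr 1
      refine Finset.sum_congr rfl fun x _ => ?_
      rw [integral_const_mul, integral_indicator_one (measurableSet_unseen M _)]
    have h2 : cubeMean (fun x => 1 / 2 * if (trace M x).card = k then (1 : ℝ) else 0) ≤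
        ∫ ω, H ω ∂(designNoise ν) := by
      rw [h1]
      refine cubeMean_mono fun x => ?_
      rw [mul_comm]
      refine mul_le_mul_of_nonneg_left ?_ (by split_ifs <;> norm_num)
      exact half_le_unseen hν (Finset.filter_subset _ _) (hpow ▸ hn)
    refine le_trans ?_ h2
    rw [cubeMean_const_mul, cubeMean_trace_card_eq, hpow, hM,
      ← Nat.centralBinom_eq_two_mul_choose]
    have h3 := four_pow_le_sqrt_mul_centralBinom hk
    have hk' : 0 < Real.sqrt k := Real.sqrt_pos.mpr (by exact_mod_cast hk)
    rw [one_div_mul_eq_div, div_div, div_le_div_iff₀ (by positivity) (by positivity)]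
    linarith
  set N := Fintype.card (Finset (Fin d) → Bool) with hN
  set s := ⨆ f ∈ influenceSubclass d K B, risk ν ftilde f with hs
  have hrisk : ∀ θ : Finset (Fin d) → Bool, risk ν ftilde (fun x => a * layered M k θ x) ≤ s :=
    fun θ => le_iSup₂_of_le (fun x => a * layered M k θ x)
      (const_mul_layered_mem_influenceSubclass ha0 ha1 hK hB k θ) le_rfl
  have hsum : ∑ θ : Finset (Fin d) → Bool, risk ν ftilde (fun x => a * layered M k θ x) ≤
      N * s := by
    refine (Finset.sum_le_sum fun θ _ => hrisk θ).trans_eq ?_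
    rw [Finset.sum_const, nsmul_eq_mul, Finset.card_univ]
  have hlow : ENNReal.ofReal (N * (a ^ 2 / (16 * Real.sqrt k))) ≤
      ∑ θ : Finset (Fin d) → Bool, risk ν ftilde (fun x => a * layered M k θ x) := by
    simp only [risk_eq_lintegral hν hft]
    have hmeas : ∀ θ : Finset (Fin d) → Bool, Measurable fun ω => ENNReal.ofReal
        (sqNorm fun x => ftilde (observe (fun x => a * layered M k θ x) ω) x -
          a * layered M k θ x) := fun θ =>
      measurable_sqNorm_sub (hft.comp (measurable_observe _)) _
    rw [← lintegral_finsetSum _ fun θ _ => hmeas θ]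
    calc ENNReal.ofReal (N * (a ^ 2 / (16 * Real.sqrt k)))
        ≤ ENNReal.ofReal (∫ ω, N * (a ^ 2 / 4 * H ω) ∂(designNoise ν)) := by
          refine ENNReal.ofReal_le_ofReal ?_
          rw [integral_const_mul, integral_const_mul]
          refine mul_le_mul_of_nonneg_left ?_ (Nat.cast_nonneg _)
          have := mul_le_mul_of_nonneg_left hHmean (show 0 ≤ a ^ 2 / 4 by positivity)
          refine le_trans (le_of_eq ?_) this
          rw [div_mul_div_comm, mul_one]; ring
      _ = ∫⁻ ω, ENNReal.ofReal (N * (a ^ 2 / 4 * H ω)) ∂(designNoise ν) :=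
          ofReal_integral_eq_lintegral_ofReal ((hHint.const_mul _).const_mul _)
            (ae_of_all _ fun ω => by have := hH0 ω; positivity)
      _ ≤ _ := by
          refine lintegral_mono fun ω => ?_
          dsimp only
          rw [← ENNReal.ofReal_sum_of_nonneg fun θ _ => sqNorm_nonneg _]
          exact ENNReal.ofReal_le_ofReal (le_sum_sqNorm ftilde M k a ω)
  have hfin := hlow.trans hsum
  rw [ENNReal.ofReal_mul (Nat.cast_nonneg _), ENNReal.ofReal_natCast] at hfin
  have hNpos : N ≠ 0 := Fintype.card_ne_zero
  exact (ENNReal.mul_le_mul_iff_right (by exact_mod_cast hNpos) (ENNReal.natCast_ne_top _)).mp hfin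

/-- Take `k` to be the ceiling of `log₄(2n)`; the factor 6 absorbs the rounding down to `n = 2`. -/
lemma exists_four_pow_ge (hn : 2 ≤ n) :
    ∃ k : ℕ, 1 ≤ k ∧ 2 * (n : ℝ) ≤ 4 ^ k ∧ 2 * (k : ℝ) ≤ 6 * Real.log n := by
  have hn' : (2 : ℝ) ≤ n := by exact_mod_cast hn
  have hlog2 := Real.log_two_gt_d9
  have hlog : Real.log 2 ≤ Real.log n := Real.log_le_log two_pos hn'
  refine ⟨Nat.clog 4 (2 * n), Nat.clog_pos (by norm_num) (by omega), ?_, ?_⟩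
  · exact_mod_cast Nat.le_pow_clog (by norm_num) (2 * n)
  · have h1 := Nat.pow_pred_clog_lt_self (b := 4) (x := 2 * n) (by norm_num) (by omega)
    have hpos : 0 < Nat.clog 4 (2 * n) := Nat.clog_pos (by norm_num) (by omega)
    obtain ⟨k, hk⟩ := Nat.exists_eq_succ_of_ne_zero hpos.ne'
    rw [hk] at h1 ⊢
    have h2 : (4 : ℝ) ^ k < 2 * n := by exact_mod_cast h1
    have h3 := Real.log_lt_log (by positivity) h2
    rw [Real.log_pow, Real.log_mul two_ne_zero (by positivity),
      show (4 : ℝ) = 2 ^ 2 by norm_num, Real.log_pow] at h3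
    push_cast at h3 ⊢
    have h4 : (k : ℝ) * (2 * Real.log 2) ≥ k * (2 * 0.69) := by gcongr; linarith
    linarith

theorem minimax_lower_bound (hν : ∀ j, IsProbabilityMeasure (ν j)) (hn : 2 ≤ n) {K B : ℝ}
    (hK : 0 < K) (hKn : K ≤ Real.sqrt (Real.log n)) (hB : 0 < B)
    (hBK : B ≤ K ^ 2 / Real.sqrt (Real.log n)) (hd : 6 * Real.log n ≤ d) :
    ENNReal.ofReal (1 / 200 * (B / Real.log n)) ≤
      ⨅ (ftilde : Sample n d → Cube d → ℝ) (_ : Measurable ftilde),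
        (⨆ f ∈ influenceSubclass d K B, risk ν ftilde f) := by
  refine le_iInf₂ fun ftilde hft => ?_
  obtain ⟨k, hk1, hkn, hkL⟩ := exists_four_pow_ge hn
  obtain ⟨M, -, hM⟩ := Finset.exists_subset_card_eq (s := (Finset.univ : Finset (Fin d)))
    (n := 2 * k) (by
      rw [Finset.card_univ, Fintype.card_fin]
      exact_mod_cast hkL.trans hd)
  have hn' : (2 : ℝ) ≤ n := by exact_mod_cast hn
  set L := Real.log n with hL
  have hL0 : 0 < L := Real.log_pos (by linarith)
  set s := Real.sqrt L with hs
  have hs0 : 0 < s := Real.sqrt_pos.mpr hL0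
  have hs2 : s ^ 2 = L := Real.sq_sqrt hL0.le
  have hBs : B * s ≤ K ^ 2 := (le_div_iff₀ hs0).mp hBK
  -- With `|M| = 2k ≤ 6s²` this amplitude gives total influence at most `√(B s) ≤ K` and
  -- `L²`-influence at most `B/2`; also `a ≤ 1` because `B ≤ K²/s ≤ s`.
  set a := Real.sqrt (B / (6 * s)) with ha
  have ha2 : a ^ 2 = B / (6 * s) := Real.sq_sqrt (by positivity)
  have hMs : Real.sqrt M.card ≤ 3 * s := by
    refine Real.sqrt_le_iff.mpr ⟨by positivity, ?_⟩
    rw [hM]; push_cast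
    nlinarith
  have hMs2 : Real.sqrt M.card ^ 2 ≤ 6 * s ^ 2 := by
    rw [Real.sq_sqrt (Nat.cast_nonneg _), hM, hs2]; push_cast; exact hkL
  have hBs1 : B ≤ s := by
    have : K ^ 2 ≤ s ^ 2 := by gcongr
    nlinarith
  have hmain := le_iSup_risk hν hft hk1 hM hkn (a := a) (K := K) (B := B) (Real.sqrt_nonneg _)
    (Real.sqrt_le_one.mpr ?_) ?_ ?_
  · refine le_trans (ENNReal.ofReal_le_ofReal ?_) hmain
    have hks : Real.sqrt k ≤ 2 * s := by
      refine Real.sqrt_le_iff.mpr ⟨by positivity, ?_⟩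
      nlinarith
    have hk0 : 0 < Real.sqrt k := Real.sqrt_pos.mpr (by exact_mod_cast hk1)
    rw [ha2, div_div, one_div_mul_eq_div, div_div, ← hs2]
    -- The constants multiply to `6 * 16 * 2 = 192 ≤ 200`.
    refine div_le_div_of_nonneg_left hB.le (by positivity) ?_
    nlinarith
  · rw [div_le_one (by positivity)]; linarith
  · refine abs_le_of_sq_le_sq' ?_ hK.le |>.2
    rw [mul_pow, ha2]
    calc B / (6 * s) * Real.sqrt M.card ^ 2 ≤ B / (6 * s) * (6 * s ^ 2) := by gcongr
      _ = B * s := by field_simp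
      _ ≤ K ^ 2 := hBs
  · rw [ha2]
    calc B / (6 * s) * Real.sqrt M.card ≤ B / (6 * s) * (3 * s) := by gcongr
      _ = B / 2 := by field_simp; norm_num
      _ ≤ B := by linarith

end LowerBound

/-! ### Measurability of the estimator. -/

section Measurability

variable {n d : ℕ}

/-- Sums over an index set that does not depend on the data, so that measurability and dependence on
the first half can be checked term by term. -/
lemma conditionalMean_eq (D : Sample n d) (i : Fin d) (b : Bool) :
    conditionalMean D i b =
      (∑ j : Fin n with j.val < n / 2, if (D j).1 i = b then (D j).2 else 0) /
        ∑ j : Fin n with j.val < n / 2, if (D j).1 i = b then (1 : ℝ) else 0 := by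
  rw [conditionalMean, firstHalfIndices, ← Finset.filter_filter, Finset.sum_filter _ _,
    Finset.sum_boole]

lemma measurableSet_design (j : Fin n) (p : Cube d → Prop) :
    MeasurableSet {D : Sample n d | p (D j).1} :=
  (measurable_fst.comp (measurable_pi_apply j)) (Set.toFinite {x | p x}).measurableSet

lemma measurable_estimatedInfluence (i : Fin d) :
    Measurable fun D : Sample n d => estimatedInfluence D i := by
  have h : ∀ b, Measurable fun D : Sample n d => conditionalMean D i b := fun b => by
    simp only [conditionalMean_eq]
    refine Measurable.div ?_ ?_
    · exact Finset.measurable_fun_sum _ fun j _ => Measurable.ite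
        (measurableSet_design j fun x => x i = b)
        (measurable_snd.comp (measurable_pi_apply j)) measurable_const
    · exact Finset.measurable_fun_sum _ fun j _ => Measurable.ite
        (measurableSet_design j fun x => x i = b)
        measurable_const measurable_const
  exact (h true).sub (h false)

lemma mem_selectedCoords {γ c₀ : ℝ} {D : Sample n d} {i : Fin d} :
    i ∈ selectedCoords γ c₀ D ↔ influenceThreshold γ c₀ n / 2 ≤ estimatedInfluence D i := by
  simp [selectedCoords]

lemma measurableSet_selectedCoords (γ c₀ : ℝ) (p : Finset (Fin d) → Prop) :
    MeasurableSet {D : Sample n d | p (selectedCoords γ c₀ D)} := by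
  have hfiber : ∀ J : Finset (Fin d),
      MeasurableSet {D : Sample n d | selectedCoords γ c₀ D = J} := fun J => by
    simp only [Finset.ext_iff, mem_selectedCoords, Set.ofPred_forall]
    refine MeasurableSet.iInter fun i => ?_
    by_cases hi : i ∈ J
    · simpa [hi] using measurableSet_le measurable_const (measurable_estimatedInfluence i)
    · simpa [hi] using measurableSet_lt (measurable_estimatedInfluence i) measurable_const
  have : {D : Sample n d | p (selectedCoords γ c₀ D)} =
      ⋃ J ∈ {J : Finset (Fin d) | p J}, {D : Sample n d | selectedCoords γ c₀ D = J} := by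
    ext D; simp
  rw [this]
  exact MeasurableSet.biUnion (Set.to_countable _) fun J _ => hfiber J

lemma measurable_empiricalCoeff (S : Finset (Fin d)) :
    Measurable fun D : Sample n d => empiricalCoeff D S :=
  (Finset.measurable_fun_sum _ fun j _ => (measurable_snd.comp (measurable_pi_apply j)).mul
    ((measurable_cube (character S)).comp
      (measurable_fst.comp (measurable_pi_apply j)))).div_const _

/-- The sets of at most `k` elements of `J`. -/
def smallSubsets (J : Finset (Fin d)) (k : ℕ) : Finset (Finset (Fin d)) :=
  J.powerset.filter fun S => S.card ≤ k

lemma mem_smallSubsets {J : Finset (Fin d)} {k : ℕ} {S : Finset (Fin d)} :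
    S ∈ smallSubsets J k ↔ S ⊆ J ∧ S.card ≤ k := by
  simp [smallSubsets]

lemma fourierEstimator_eq (γ c₀ : ℝ) (D : Sample n d) (x : Cube d) :
    fourierEstimator γ c₀ D x = max 0 (min (∑ S ∈ smallSubsets (selectedCoords γ c₀ D)
      (degreeCutoff γ c₀ n), empiricalCoeff D S * character S x) 1) := rfl

open Classical in
theorem measurable_fourierEstimator (γ c₀ : ℝ) :
    Measurable (fourierEstimator γ c₀ : Sample n d → Cube d → ℝ) := by
  refine measurable_pi_lambda _ fun x => ?_
  have h : ∀ D : Sample n d, (∑ S ∈ smallSubsets (selectedCoords γ c₀ D)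
      (degreeCutoff γ c₀ n), empiricalCoeff D S * character S x) =
      ∑ S, if S ∈ smallSubsets (selectedCoords γ c₀ D) (degreeCutoff γ c₀ n) then
        empiricalCoeff D S * character S x else 0 := fun D => by
    rw [Finset.sum_ite_mem, Finset.univ_inter]
  simp only [fourierEstimator_eq, h]
  refine measurable_const.max (Measurable.min (Finset.measurable_fun_sum _ fun S _ => ?_)
    measurable_const)
  exact Measurable.ite (measurableSet_selectedCoords γ c₀
    fun J => S ∈ smallSubsets J (degreeCutoff γ c₀ n))
    ((measurable_empiricalCoeff S).mul_const _) measurable_const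

end Measurability

/-! ### Independence of the two half-samples; variance of the coefficients. -/

section Halves

open ProbabilityTheory

variable {n d : ℕ} {ν : Fin n → Measure ℝ}

/-- Extension of a partial sample by an arbitrary value. -/
def extendSample (T : Finset (Fin n)) (a : T → Cube d × ℝ) : Sample n d :=
  fun j => if h : j ∈ T then a ⟨j, h⟩ else (fun _ => false, 0)

lemma measurable_extendSample (T : Finset (Fin n)) :
    Measurable (extendSample T : (T → Cube d × ℝ) → Sample n d) := by
  refine measurable_pi_lambda _ fun j => ?_
  unfold extendSample
  split_ifs with h
  · exact measurable_pi_apply _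
  · exact measurable_const

/-- A function that sees only the coordinates in `T` factors through restriction to `T`, the filler
value being immaterial; disjoint blocks of the product measure are independent. -/
lemma lintegral_mul_of_disjoint (hν : ∀ j, IsProbabilityMeasure (ν j)) {T U : Finset (Fin n)}
    (hTU : Disjoint T U) {F G : Sample n d → ℝ≥0∞} (hF : Measurable F) (hG : Measurable G)
    (hFT : ∀ ω ω', (∀ j ∈ T, ω j = ω' j) → F ω = F ω')
    (hGU : ∀ ω ω', (∀ j ∈ U, ω j = ω' j) → G ω = G ω') :
    ∫⁻ ω, F ω * G ω ∂(designNoise ν) =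
      (∫⁻ ω, F ω ∂(designNoise ν)) * ∫⁻ ω, G ω ∂(designNoise ν) := by
  have hind : iIndepFun (fun (j : Fin n) (ω : Sample n d) => ω j) (designNoise ν) :=
    iIndepFun_pi (X := fun _ => id) fun _ => aemeasurable_id
  have h1 := (hind.indepFun_finset T U hTU fun j => measurable_pi_apply j).comp
    (hF.comp (measurable_extendSample T)) (hG.comp (measurable_extendSample U))
  have hFe : ((F ∘ extendSample T) ∘ fun (ω : Sample n d) (j : T) => ω j) = F := by
    funext ω
    exact hFT _ _ fun j hj => by simp [extendSample, hj]
  have hGe : ((G ∘ extendSample U) ∘ fun (ω : Sample n d) (j : U) => ω j) = G := by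
    funext ω
    exact hGU _ _ fun j hj => by simp [extendSample, hj]
  rw [hFe, hGe] at h1
  exact lintegral_mul_eq_lintegral_mul_lintegral_of_indepFun hF hG h1

lemma selectedCoords_congr {γ c₀ : ℝ} {D D' : Sample n d}
    (h : ∀ j : Fin n, j.val < n / 2 → D j = D' j) :
    selectedCoords γ c₀ D = selectedCoords γ c₀ D' := by
  have hm : ∀ i b, conditionalMean D i b = conditionalMean D' i b := fun i b => by
    rw [conditionalMean_eq, conditionalMean_eq]
    congr 1 <;> exact Finset.sum_congr rfl fun j hj => by rw [h j (Finset.mem_filter.mp hj).2]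
  ext i
  simp only [mem_selectedCoords, estimatedInfluence, hm]

lemma empiricalCoeff_congr {S : Finset (Fin d)} {D D' : Sample n d}
    (h : ∀ j : Fin n, n / 2 ≤ j.val → D j = D' j) :
    empiricalCoeff D S = empiricalCoeff D' S := by
  unfold empiricalCoeff
  congr 1
  exact Finset.sum_congr rfl fun j hj => by rw [h j (Finset.mem_filter.mp hj).2]

lemma card_first_half (n : ℕ) :
    (Finset.univ.filter fun j : Fin n => j.val < n / 2).card = n / 2 := by
  rw [Fin.card_filter_val_lt]
  omega

lemma card_second_half (n : ℕ) :
    (Finset.univ.filter fun j : Fin n => n / 2 ≤ j.val).card = n - n / 2 := by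
  have h := Finset.card_filter_add_card_filter_not (s := (Finset.univ : Finset (Fin n)))
    (fun j => j.val < n / 2)
  simp only [not_lt, card_first_half, Finset.card_univ, Fintype.card_fin] at h
  omega

variable {σ : ℝ}

/-- The empirical coefficient is unbiased, so its mean squared error is the variance of an average
of independent terms. -/
lemma lintegral_empiricalCoeff_sub_sq_le (hσ : 0 < σ) (hν : ∀ j, IsNoiseLaw σ (ν j))
    (hn : 2 ≤ n) {f : Cube d → ℝ} (hf : ∀ x, f x ∈ Set.Icc (0 : ℝ) 1) (S : Finset (Fin d)) :
    ∫⁻ ω, ENNReal.ofReal ((empiricalCoeff (observe f ω) S - fourierCoeff f S) ^ 2)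
      ∂(designNoise ν) ≤ ENNReal.ofReal ((1 + 4 * σ ^ 2) / (n - n / 2 : ℕ)) := by
  have hp : ∀ j, IsProbabilityMeasure (ν j) := fun j => (hν j).isProbabilityMeasure
  have := isProbabilityMeasure_designNoise (d := d) hp
  set T : Finset (Fin n) := {j | n / 2 ≤ j.val} with hT
  have hTc : T.card = n - n / 2 := card_second_half n
  have hN : (0 : ℝ) < (n - n / 2 : ℕ) := by
    have : 0 < n - n / 2 := by omega
    exact_mod_cast this
  set N : ℝ := ((n - n / 2 : ℕ) : ℝ) with hNdef
  set Z : Cube d × ℝ → ℝ := fun p => (f p.1 + p.2) * character S p.1 with hZ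
  have hZL : ∀ j, MemLp Z 2 ((cubeMeasure d).prod (ν j)) := fun j =>
    memLp_response_mul_character (hν j) f S
  have hZP : ∀ j, MemLp (fun ω : Sample n d => Z (ω j)) 2 (designNoise ν) := fun j =>
    (hZL j).comp_measurePreserving (measurePreserving_eval _ j)
  have hemp : (fun ω : Sample n d => empiricalCoeff (observe f ω) S) =
      fun ω => N⁻¹ * (∑ j ∈ T, fun ω : Sample n d => Z (ω j)) ω := by
    funext ω
    rw [Finset.sum_apply, empiricalCoeff, div_eq_inv_mul]
    rfl
  have hmean : ∫ ω, empiricalCoeff (observe f ω) S ∂(designNoise ν) = fourierCoeff f S := by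
    rw [hemp, integral_const_mul]
    simp only [Finset.sum_apply]
    rw [integral_finsetSum _ fun j _ => (hZP j).integrable one_le_two]
    have : ∀ j ∈ T, ∫ ω : Sample n d, Z (ω j) ∂(designNoise ν) = fourierCoeff f S := fun j _ => by
      rw [← integral_response_mul_character (hν j) f S]
      exact integral_comp_eval (hZL j).1
    rw [Finset.sum_congr rfl this, Finset.sum_const, hTc, nsmul_eq_mul, ← hNdef]
    field_simp
  have hvar : variance (fun ω : Sample n d => empiricalCoeff (observe f ω) S) (designNoise ν) ≤
      (1 + 4 * σ ^ 2) / N := by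
    rw [hemp, variance_const_mul, IndepFun.variance_sum fun j _ => hZP j]
    · have hj : ∀ j ∈ T, variance (fun ω : Sample n d => Z (ω j)) (designNoise ν) ≤
          1 + 4 * σ ^ 2 := fun j _ => by
        refine le_of_eq_of_le ?_ (variance_response_mul_character_le hσ (hν j) hf S)
        exact (measurePreserving_eval (fun j => (cubeMeasure d).prod (ν j)) j).variance_fun_comp
          (hZL j).1.aemeasurable
      refine (mul_le_mul_of_nonneg_left (Finset.sum_le_sum hj) (sq_nonneg _)).trans_eq ?_
      rw [Finset.sum_const, hTc, nsmul_eq_mul, ← hNdef]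
      field_simp
    · intro i _ j _ hij
      exact (iIndepFun_pi fun j => (hZL j).1.aemeasurable).indepFun hij
  have hL : MemLp (fun ω : Sample n d => empiricalCoeff (observe f ω) S) 2 (designNoise ν) := by
    rw [hemp]
    exact (memLp_finsetSum' _ fun j _ => hZP j).const_mul _
  have h1 := evariance_eq_lintegral_ofReal (fun ω : Sample n d => empiricalCoeff (observe f ω) S)
    (designNoise ν)
  rw [hmean] at h1
  rw [← h1, ← ofReal_variance hL]
  exact ENNReal.ofReal_le_ofReal hvar

end Halves

/-! ### Concentration of the estimated influences. -/

section Concentration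

open ProbabilityTheory

variable {n d : ℕ} {ν : Fin n → Measure ℝ} {σ : ℝ}

/-- One tail bound for all the sums needed: the response sums with both signs, and the counts of
design points (with `s = 0`). -/
lemma measureReal_sum_ge_le (hν : ∀ j, IsNoiseLaw σ (ν j)) {g s : Cube d → ℝ}
    (hg : ∀ x, |g x| ≤ 1) (hg0 : cubeMean g = 0) (hs : ∀ x, |s x| ≤ 1) (T : Finset (Fin n))
    {u : ℝ} (hu : 0 ≤ u) :
    (designNoise ν).real {ω : Sample n d | T.card * u ≤ ∑ j ∈ T, (g (ω j).1 + s (ω j).1 * (ω j).2)} ≤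
      Real.exp (-(T.card * u ^ 2 / (2 * (1 + σ ^ 2)))) := by
  have hp : ∀ j, IsProbabilityMeasure (ν j) := fun j => (hν j).isProbabilityMeasure
  have hsub := fun j => hasSubgaussianMGF_prod (hν j) hg hg0 hs
  have hind : iIndepFun (fun (j : Fin n) (ω : Sample n d) => g (ω j).1 + s (ω j).1 * (ω j).2)
      (designNoise ν) :=
    iIndepFun_pi (X := fun _ (p : Cube d × ℝ) => g p.1 + s p.1 * p.2)
      fun j => (hsub j).aemeasurable
  have hsubP : ∀ j ∈ T, HasSubgaussianMGF
      (fun ω : Sample n d => g (ω j).1 + s (ω j).1 * (ω j).2) (Real.toNNReal (1 + σ ^ 2))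
      (designNoise ν) := fun j _ => by
    refine HasSubgaussianMGF.of_map (Y := fun ω : Sample n d => ω j)
      (X := fun p : Cube d × ℝ => g p.1 + s p.1 * p.2) (measurable_pi_apply j).aemeasurable ?_
    have := (measurePreserving_eval (fun j => (cubeMeasure d).prod (ν j)) j).map_eq
    exact (congrArg _ this).mpr (hsub j)
  refine (HasSubgaussianMGF.measure_sum_ge_le_of_iIndepFun hind hsubP
    (show (0 : ℝ) ≤ T.card * u by positivity)).trans ?_
  refine Real.exp_le_exp.mpr (le_of_eq ?_)
  rw [Finset.sum_const, nsmul_eq_mul]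
  push_cast
  rw [Real.coe_toNNReal _ (by positivity)]
  rcases Nat.eq_zero_or_pos T.card with h | h
  · simp [h]
  · have : (0 : ℝ) < T.card := by exact_mod_cast h
    field_simp

/-- The mean of `f` over the points whose `i`-th coordinate is `b`. -/
def restrictedMean (f : Cube d → ℝ) (i : Fin d) (b : Bool) : ℝ :=
  cubeMean fun x => f (Function.update x i b)

lemma influence_eq_restrictedMean_sub {f : Cube d → ℝ} (hf : Monotone f) (i : Fin d) :
    influence f i = restrictedMean f i true - restrictedMean f i false := by
  rw [influence, restrictedMean, restrictedMean, ← cubeMean_sub]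
  congr 1; ext x
  rw [abs_of_nonneg (discreteDeriv_nonneg hf i x), discreteDeriv]

lemma cubeMean_indicator (h : Cube d → ℝ) (i : Fin d) (b : Bool) :
    cubeMean (fun x => if x i = b then h x else 0) =
      2⁻¹ * cubeMean fun x => h (Function.update x i b) := by
  have h1 := cubeMean_flip i (fun x => if x i = b then h x else 0)
  have h2 : cubeMean (fun x => h (Function.update x i b)) =
      cubeMean (fun x => if x i = b then h x else 0) +
        cubeMean (fun x => if flip i x i = b then h (flip i x) else 0) := by
    rw [← cubeMean_add]
    congr 1; ext x
    have hx := Function.update_eq_self i x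
    cases hxi : x i <;> cases b <;> rw [hxi] at hx <;> simp [flip, hxi, hx]
  rw [h2, h1]; ring

/-- The response sum over the first half with `i`-th coordinate `b`, centered. -/
def centeredSum (f : Cube d → ℝ) (i : Fin d) (b : Bool) (ω : Sample n d) : ℝ :=
  ∑ j : Fin n with j.val < n / 2, ((if (ω j).1 i = b then f (ω j).1 - restrictedMean f i b else 0) +
    (if (ω j).1 i = b then 1 else 0) * (ω j).2)

/-- Half the size of the first half less the number of its points with `i`-th coordinate `b`. -/
def countDeficit (i : Fin d) (b : Bool) (ω : Sample n d) : ℝ :=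
  ∑ j : Fin n with j.val < n / 2, (1 / 2 - if (ω j).1 i = b then (1 : ℝ) else 0)

/-- The deviation is exactly the centered sum over the count. The count exceeds a quarter of the
first half, so dividing by it costs a factor 4. -/
lemma abs_conditionalMean_sub_lt {f : Cube d → ℝ} {i : Fin d} {b : Bool} {ω : Sample n d}
    {u : ℝ} (h1 : |centeredSum f i b ω| < (n / 2 : ℕ) * u)
    (h2 : countDeficit i b ω < (n / 2 : ℕ) * (1 / 4)) :
    |conditionalMean (observe f ω) i b - restrictedMean f i b| < 4 * u := by
  set m : ℝ := ((n / 2 : ℕ) : ℝ) with hm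
  have hm0 : 0 ≤ m := Nat.cast_nonneg _
  set N : ℝ := ∑ j : Fin n with j.val < n / 2, if (ω j).1 i = b then (1 : ℝ) else 0 with hN
  have hNm : m * (1 / 4) < N := by
    have : countDeficit i b ω = m * (1 / 2) - N := by
      rw [countDeficit, Finset.sum_sub_distrib, Finset.sum_const, card_first_half, nsmul_eq_mul]
    linarith
  have hN0 : 0 < N := lt_of_le_of_lt (by positivity) hNm
  have hcs : centeredSum f i b ω = (∑ j : Fin n with j.val < n / 2,
      if (ω j).1 i = b then f (ω j).1 + (ω j).2 else 0) - restrictedMean f i b * N := by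
    rw [centeredSum, hN, Finset.mul_sum, ← Finset.sum_sub_distrib]
    refine Finset.sum_congr rfl fun j _ => ?_
    split_ifs <;> ring
  have hcm : conditionalMean (observe f ω) i b - restrictedMean f i b =
      centeredSum f i b ω / N := by
    rw [conditionalMean_eq, hcs, sub_div, mul_div_cancel_right₀ _ hN0.ne']
    rfl
  have hu : 0 < u := by
    by_contra! hu
    have := (abs_nonneg _).trans_lt h1
    nlinarith
  rw [hcm, abs_div, abs_of_pos hN0, div_lt_iff₀ hN0]
  nlinarith

/-- The event that some estimated conditional mean is off by more than the tolerance `4 * u`. -/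
def deviationEvent (f : Cube d → ℝ) (u : ℝ) : Set (Sample n d) :=
  ⋃ a : Fin d × Bool, {ω | (n / 2 : ℕ) * u ≤ |centeredSum f a.1 a.2 ω|} ∪
    {ω | (n / 2 : ℕ) * (1 / 4) ≤ countDeficit a.1 a.2 ω}

lemma abs_estimatedInfluence_sub_lt {f : Cube d → ℝ} (hf : Monotone f) {u : ℝ} {ω : Sample n d}
    (hω : ω ∉ deviationEvent f u) (i : Fin d) :
    |estimatedInfluence (observe f ω) i - influence f i| < 8 * u := by
  simp only [deviationEvent, Set.mem_iUnion, Set.mem_union, Set.mem_ofPred_eq, not_exists, not_or,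
    not_le] at hω
  have ht := abs_lt.mp (abs_conditionalMean_sub_lt (hω (i, true)).1 (hω (i, true)).2)
  have hf' := abs_lt.mp (abs_conditionalMean_sub_lt (hω (i, false)).1 (hω (i, false)).2)
  rw [influence_eq_restrictedMean_sub hf, estimatedInfluence, abs_lt]
  constructor <;> linarith [ht.1, ht.2, hf'.1, hf'.2]

lemma restrictedMean_mem_Icc {f : Cube d → ℝ} (hf : ∀ x, f x ∈ Set.Icc (0 : ℝ) 1) (i : Fin d)
    (b : Bool) : restrictedMean f i b ∈ Set.Icc (0 : ℝ) 1 :=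
  ⟨cubeMean_nonneg fun _ => (hf _).1,
    (cubeMean_mono fun _ => (hf _).2).trans_eq (cubeMean_const 1)⟩

lemma measureReal_deviationEvent_le (hν : ∀ j, IsNoiseLaw σ (ν j)) {f : Cube d → ℝ}
    (hf : ∀ x, f x ∈ Set.Icc (0 : ℝ) 1) {u : ℝ} (hu : 0 ≤ u) (hu4 : u ≤ 1 / 4) :
    (designNoise ν).real (deviationEvent f u : Set (Sample n d)) ≤
      6 * d * Real.exp (-((n / 2 : ℕ) * u ^ 2 / (2 * (1 + σ ^ 2)))) := by
  set m : ℝ := ((n / 2 : ℕ) : ℝ) with hm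
  set E := Real.exp (-(m * u ^ 2 / (2 * (1 + σ ^ 2)))) with hE
  have hp : ∀ j, IsProbabilityMeasure (ν j) := fun j => (hν j).isProbabilityMeasure
  have := isProbabilityMeasure_designNoise (d := d) hp
  have hT := card_first_half n
  have hpart : ∀ (i : Fin d) (b : Bool), (designNoise ν).real ({ω : Sample n d | m * u ≤
      |centeredSum f i b ω|} ∪ {ω | m * (1 / 4) ≤ countDeficit i b ω}) ≤ 3 * E := by
    intro i b
    set r := restrictedMean f i b with hr
    have hr01 := restrictedMean_mem_Icc hf i b
    set g : Cube d → ℝ := fun x => if x i = b then f x - r else 0 with hg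
    set s : Cube d → ℝ := fun x => if x i = b then 1 else 0 with hs
    have hg1 : ∀ x, |g x| ≤ 1 := fun x => by
      have := hf x
      simp only [hg]
      split_ifs
      · rw [abs_le]; constructor <;> linarith [this.1, this.2, hr01.1, hr01.2]
      · simp
    have hs1 : ∀ x, |s x| ≤ 1 := fun x => by
      simp only [hs]; split_ifs <;> simp
    have hg0 : cubeMean g = 0 := by
      rw [hg, cubeMean_indicator, cubeMean_sub, cubeMean_const, hr, restrictedMean]
      simp
    have h1 := measureReal_sum_ge_le hν hg1 hg0 hs1 {j : Fin n | j.val < n / 2} hu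
    have h2 := measureReal_sum_ge_le hν (g := fun x => -g x) (s := fun x => -s x)
      (by simpa using hg1) (by rw [cubeMean_neg, hg0, neg_zero]) (by simpa using hs1)
      {j : Fin n | j.val < n / 2} hu
    have h3 := measureReal_sum_ge_le hν (g := fun x : Cube d => 1 / 2 - if x i = b then (1 : ℝ) else 0)
      (s := fun _ => 0) (fun x => by split_ifs <;> norm_num [abs_le])
      (by rw [cubeMean_sub, cubeMean_const, cubeMean_indicator, cubeMean_const]; norm_num)
      (by simp) {j : Fin n | j.val < n / 2} (show (0 : ℝ) ≤ 1 / 4 by norm_num)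
    rw [hT, ← hm] at h1 h2 h3
    have h3' : (designNoise ν).real {ω : Sample n d | m * (1 / 4) ≤ countDeficit i b ω} ≤ E := by
      simp only [zero_mul, add_zero] at h3
      -- Since `u ≤ 1/4`, the count tail is no larger than the response tails. Three tails for each
      -- of the `2d` pairs give the factor `6d`.
      refine h3.trans (Real.exp_le_exp.mpr (neg_le_neg ?_))
      gcongr
    have h12 : (designNoise ν).real {ω : Sample n d | m * u ≤ |centeredSum f i b ω|} ≤
        E + E := by
      refine (measureReal_mono ?_).trans
        ((measureReal_union_le _ _).trans (add_le_add h1 h2))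
      intro ω hω
      rcases le_abs.mp (show m * u ≤ |centeredSum f i b ω| from hω) with h | h
      · exact Or.inl h
      · refine Or.inr (h.trans_eq ?_)
        rw [centeredSum, ← Finset.sum_neg_distrib]
        exact Finset.sum_congr rfl fun j _ => by simp only [hg, hs]; ring
    refine (measureReal_union_le _ _).trans ?_
    linarith
  refine (measureReal_iUnion_fintype_le _).trans ?_
  refine (Finset.sum_le_sum fun a _ => hpart a.1 a.2).trans_eq ?_
  rw [Finset.sum_const, Finset.card_univ, Fintype.card_prod, Fintype.card_fin, Fintype.card_bool,
    nsmul_eq_mul]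
  push_cast; ring

end Concentration

/-! ### Risk bound for the estimator at every sample size. -/

section UpperBound

variable {n d : ℕ} {ν : Fin n → Measure ℝ} {σ : ℝ}

/-- Weighting by `δ^{|S|-k} ≥ 1` and dropping the size constraint makes the sum factor as `δ^{-k}
(1+δ)^{|J|}`. The second factor stays below `e^{4K}` once `δ|J| ≤ 4K`. -/
lemma card_smallSubsets_le (J : Finset (Fin d)) (k : ℕ) {δ : ℝ} (hδ0 : 0 < δ) (hδ1 : δ ≤ 1) :
    ((smallSubsets J k).card : ℝ) ≤ δ⁻¹ ^ k * Real.exp (δ * J.card) := by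
  calc ((smallSubsets J k).card : ℝ) = ∑ S ∈ smallSubsets J k, (1 : ℝ) := by simp
    _ ≤ ∑ S ∈ smallSubsets J k, δ⁻¹ ^ k * δ ^ S.card := by
        refine Finset.sum_le_sum fun S hS => ?_
        rw [inv_pow, ← div_eq_inv_mul, one_le_div (by positivity)]
        exact pow_le_pow_of_le_one hδ0.le hδ1 (mem_smallSubsets.mp hS).2
    _ ≤ ∑ S ∈ J.powerset, δ⁻¹ ^ k * δ ^ S.card :=
        Finset.sum_le_sum_of_subset_of_nonneg (Finset.filter_subset _ _)
          fun _ _ _ => by positivity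
    _ = δ⁻¹ ^ k * (δ + 1) ^ J.card := by
        rw [← Finset.mul_sum, ← Finset.sum_pow_mul_eq_add_pow]
        simp
    _ ≤ δ⁻¹ ^ k * Real.exp (δ * J.card) := by
        gcongr
        rw [mul_comm, Real.exp_nat_mul]
        gcongr
        exact Real.add_one_le_exp δ

lemma sqNorm_fourierEstimator_sub_le_one (γ c₀ : ℝ) (D : Sample n d) {f : Cube d → ℝ}
    (hf : ∀ x, f x ∈ Set.Icc (0 : ℝ) 1) :
    sqNorm (fun x => fourierEstimator γ c₀ D x - f x) ≤ 1 :=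
  sqNorm_clip_sub_le_one hf fun x => ∑ S ∈ smallSubsets (selectedCoords γ c₀ D)
    (degreeCutoff γ c₀ n), empiricalCoeff D S * character S x

lemma risk_fourierEstimator_le_one (hν : ∀ j, IsProbabilityMeasure (ν j)) (γ c₀ : ℝ)
    {f : Cube d → ℝ} (hf : ∀ x, f x ∈ Set.Icc (0 : ℝ) 1) :
    risk ν (fourierEstimator γ c₀) f ≤ 1 := by
  have := isProbabilityMeasure_designNoise (d := d) hν
  rw [risk_eq_lintegral hν (measurable_fourierEstimator γ c₀)]
  refine (lintegral_mono fun ω => ENNReal.ofReal_le_one.mpr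
    (sqNorm_fourierEstimator_sub_le_one γ c₀ _ hf)).trans ?_
  simp

lemma one_le_degreeCutoff (γ c₀ : ℝ) (n : ℕ) : 1 ≤ degreeCutoff γ c₀ n := le_max_right _ _

lemma influenceThreshold_pos (γ c₀ : ℝ) (n : ℕ) : 0 < influenceThreshold γ c₀ n := Real.exp_pos _

lemma influenceThreshold_le_one {γ : ℝ} (hγ : 0 < γ) (c₀ : ℝ) (n : ℕ) :
    influenceThreshold γ c₀ n ≤ 1 := by
  refine Real.exp_le_one_iff.mpr ?_
  have : (0 : ℝ) ≤ degreeCutoff γ c₀ n := Nat.cast_nonneg _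
  nlinarith

/-- The event that `S` enters the estimator while at most `4 * K / δ` coordinates are selected. -/
def inclusionEvent (γ c₀ K : ℝ) (S : Finset (Fin d)) : Set (Sample n d) :=
  {D | S ∈ smallSubsets (selectedCoords γ c₀ D) (degreeCutoff γ c₀ n) ∧
    influenceThreshold γ c₀ n * (selectedCoords γ c₀ D).card ≤ 4 * K}

lemma measurableSet_inclusionEvent (γ c₀ K : ℝ) (S : Finset (Fin d)) :
    MeasurableSet (inclusionEvent γ c₀ K S : Set (Sample n d)) :=
  measurableSet_selectedCoords γ c₀ fun J => S ∈ smallSubsets J (degreeCutoff γ c₀ n) ∧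
    influenceThreshold γ c₀ n * J.card ≤ 4 * K

lemma sqNorm_fourierEstimator_sub_le (γ c₀ : ℝ) {K B : ℝ} {f : Cube d → ℝ}
    (hf : f ∈ influenceSubclass d K B) {ω : Sample n d}
    (hω : ω ∉ deviationEvent f (influenceThreshold γ c₀ n / 32)) :
    sqNorm (fun x => fourierEstimator γ c₀ (observe f ω) x - f x) ≤
      B / (4 * degreeCutoff γ c₀ n) +
        3 ^ degreeCutoff γ c₀ n * Real.sqrt (influenceThreshold γ c₀ n) * K +
      ∑ S, (inclusionEvent γ c₀ K S).indicator 1 (observe f ω) *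
        (empiricalCoeff (observe f ω) S - fourierCoeff f S) ^ 2 := by
  obtain ⟨⟨⟨hmono, hIcc⟩, hK⟩, hB⟩ := hf
  set k := degreeCutoff γ c₀ n with hk
  set δ := influenceThreshold γ c₀ n with hδ
  have hδ0 : 0 < δ := influenceThreshold_pos γ c₀ n
  have hk1 : 1 ≤ k := one_le_degreeCutoff γ c₀ n
  set J := selectedCoords γ c₀ (observe f ω) with hJ
  -- The tolerance `8 * (δ/32) = δ/4` around the threshold `δ/2` places unselected influences below
  -- `3δ/4` and selected ones above `δ/4`.
  have hdev : ∀ i, |estimatedInfluence (observe f ω) i - influence f i| < 8 * (δ / 32) :=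
    abs_estimatedInfluence_sub_lt hmono hω
  have hout : ∀ i, i ∉ J → influence f i ≤ δ := fun i hi => by
    rw [hJ, mem_selectedCoords, not_le, ← hδ] at hi
    have := (abs_lt.mp (hdev i)).1
    linarith
  have hin : ∀ i ∈ J, δ / 4 ≤ influence f i := fun i hi => by
    rw [hJ, mem_selectedCoords, ← hδ] at hi
    have := (abs_lt.mp (hdev i)).2
    linarith
  have hcard : δ * J.card ≤ 4 * K := by
    have h1 : ∑ i ∈ J, δ / 4 ≤ totalInfluence f :=
      (Finset.sum_le_sum hin).trans (Finset.sum_le_sum_of_subset_of_nonneg (Finset.subset_univ J)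
        fun i _ _ => influence_nonneg f i)
    rw [Finset.sum_const, nsmul_eq_mul] at h1
    linarith
  have h1 := sqNorm_clip_sub_le hIcc (smallSubsets J k) (empiricalCoeff (observe f ω))
  have h2 := bias_le hIcc J hk1 hout
  simp only [← mem_smallSubsets] at h2
  have h3 : ∑ S ∈ smallSubsets J k, (empiricalCoeff (observe f ω) S - fourierCoeff f S) ^ 2 =
      ∑ S, (inclusionEvent γ c₀ K S).indicator 1 (observe f ω) *
        (empiricalCoeff (observe f ω) S - fourierCoeff f S) ^ 2 := by
    have hmem : ∀ S, observe f ω ∈ inclusionEvent γ c₀ K S ↔ S ∈ smallSubsets J k :=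
      fun S => and_iff_left hcard
    have hind : ∀ S, (inclusionEvent γ c₀ K S).indicator (1 : Sample n d → ℝ) (observe f ω) =
        if S ∈ smallSubsets J k then 1 else 0 := fun S => by
      by_cases h : S ∈ smallSubsets J k
      · rw [Set.indicator_of_mem ((hmem S).mpr h), if_pos h, Pi.one_apply]
      · rw [Set.indicator_of_notMem (mt (hmem S).mp h), if_neg h]
    simp only [hind, ite_mul, one_mul, zero_mul, Finset.sum_ite_mem, Finset.univ_inter]
  have h4 : totalInfluenceTwo f / (4 * k) ≤ B / (4 * k) := by gcongr
  have h5 : 3 ^ k * Real.sqrt δ * totalInfluence f ≤ 3 ^ k * Real.sqrt δ * K := by gcongr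
  rw [h3] at h1
  calc _ ≤ _ := h1
    _ ≤ _ := by linarith

/-- A bound for the risk of the Fourier estimator at every sample size. -/
theorem risk_fourierEstimator_le (hσ : 0 < σ) (hν : ∀ j, IsNoiseLaw σ (ν j)) (hn : 2 ≤ n)
    {γ : ℝ} (hγ : 0 < γ) (c₀ : ℝ) {K B : ℝ} (hK : 0 ≤ K) (hB : 0 ≤ B) {f : Cube d → ℝ}
    (hf : f ∈ influenceSubclass d K B) :
    risk ν (fourierEstimator γ c₀) f ≤ ENNReal.ofReal
      (B / (4 * degreeCutoff γ c₀ n) +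
        3 ^ degreeCutoff γ c₀ n * Real.sqrt (influenceThreshold γ c₀ n) * K +
        (influenceThreshold γ c₀ n)⁻¹ ^ degreeCutoff γ c₀ n * Real.exp (4 * K) *
          ((1 + 4 * σ ^ 2) / (n - n / 2 : ℕ)) +
        6 * d * Real.exp (-((n / 2 : ℕ) * (influenceThreshold γ c₀ n / 32) ^ 2 /
          (2 * (1 + σ ^ 2))))) := by
  have hp : ∀ j, IsProbabilityMeasure (ν j) := fun j => (hν j).isProbabilityMeasure
  have := isProbabilityMeasure_designNoise (d := d) hp
  have hIcc := hf.1.1.2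
  have hδ0 := influenceThreshold_pos γ c₀ n
  have hδ1 := influenceThreshold_le_one hγ c₀ n
  set k := degreeCutoff γ c₀ n with hk
  set δ := influenceThreshold γ c₀ n with hδ
  set b := B / (4 * k) + 3 ^ k * Real.sqrt δ * K with hb
  have hb0 : 0 ≤ b := by positivity
  set V := (1 + 4 * σ ^ 2) / ((n - n / 2 : ℕ) : ℝ) with hV
  have hV0 : 0 ≤ V := by positivity
  set Bad : Set (Sample n d) := deviationEvent f (δ / 32) with hBad
  set F : Finset (Fin d) → Sample n d → ℝ≥0∞ := fun S ω =>
    (inclusionEvent γ c₀ K S).indicator 1 (observe f ω) with hF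
  set G : Finset (Fin d) → Sample n d → ℝ≥0∞ := fun S ω =>
    ENNReal.ofReal ((empiricalCoeff (observe f ω) S - fourierCoeff f S) ^ 2) with hG
  have hFm : ∀ S, Measurable (F S) := fun S =>
    (measurable_one.indicator (measurableSet_inclusionEvent γ c₀ K S)).comp (measurable_observe f)
  have hGm : ∀ S, Measurable (G S) := fun S =>
    ((((measurable_empiricalCoeff S).comp (measurable_observe f)).sub_const _).pow_const
      2).ennreal_ofReal
  -- On the bad event clipping bounds the loss by 1, so only its probability enters.
  have hpt : ∀ ω, ENNReal.ofReal (sqNorm fun x => fourierEstimator γ c₀ (observe f ω) x - f x) ≤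
      (ENNReal.ofReal b + ∑ S, F S ω * G S ω) + Bad.indicator 1 ω := by
    intro ω
    by_cases hω : ω ∈ Bad
    · rw [Set.indicator_of_mem hω]
      exact (ENNReal.ofReal_le_one.mpr (sqNorm_fourierEstimator_sub_le_one γ c₀ _ hIcc)).trans
        le_add_self
    · rw [Set.indicator_of_notMem hω, add_zero]
      refine (ENNReal.ofReal_le_ofReal
        (sqNorm_fourierEstimator_sub_le γ c₀ hf hω)).trans_eq ?_
      have hind0 : ∀ S : Finset (Fin d), (0 : ℝ) ≤
          (inclusionEvent γ c₀ K S).indicator 1 (observe f ω) :=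
        fun S => Set.indicator_nonneg (fun _ _ => zero_le_one) _
      rw [ENNReal.ofReal_add hb0 (Finset.sum_nonneg fun S _ =>
        mul_nonneg (hind0 S) (sq_nonneg _)),
        ENNReal.ofReal_sum_of_nonneg fun S _ => mul_nonneg (hind0 S) (sq_nonneg _)]
      congr 1
      refine Finset.sum_congr rfl fun S _ => ?_
      rw [ENNReal.ofReal_mul (hind0 S)]
      congr 1
      by_cases h : observe f ω ∈ inclusionEvent γ c₀ K S <;> simp [hF, h]
  -- Inclusion of `S` is decided by the first half, its coefficient error by the second.
  have hindep : ∀ S, ∫⁻ ω, F S ω * G S ω ∂(designNoise ν) =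
      (∫⁻ ω, F S ω ∂(designNoise ν)) * ∫⁻ ω, G S ω ∂(designNoise ν) := fun S => by
    refine lintegral_mul_of_disjoint hp (T := {j | j.val < n / 2}) (U := {j | n / 2 ≤ j.val})
      (Finset.disjoint_filter.mpr fun j _ h1 h2 => absurd h1 (not_lt.mpr h2)) (hFm S) (hGm S)
      (fun ω ω' h => ?_) (fun ω ω' h => ?_)
    · have : selectedCoords γ c₀ (observe f ω) = selectedCoords γ c₀ (observe f ω') :=
        selectedCoords_congr fun j hj => by simp only [observe, h j (by simpa using hj)]
      have hiff : observe f ω ∈ inclusionEvent γ c₀ K S ↔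
          observe f ω' ∈ inclusionEvent γ c₀ K S := by
        simp only [inclusionEvent, Set.mem_ofPred_eq, this]
      by_cases hmem : observe f ω' ∈ inclusionEvent γ c₀ K S
      · simp only [hF, Set.indicator_of_mem hmem, Set.indicator_of_mem (hiff.mpr hmem),
          Pi.one_apply]
      · simp only [hF, Set.indicator_of_notMem hmem, Set.indicator_of_notMem (mt hiff.mp hmem)]
    · have : empiricalCoeff (observe f ω) S = empiricalCoeff (observe f ω') S :=
        empiricalCoeff_congr fun j hj => by simp only [observe, h j (by simpa using hj)]
      simp only [hG, this]
  -- The cardinality condition built into `inclusionEvent` makes this count bounded for every `ω`,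
  -- inside the bad event too.
  have hcount : ∑ S, ∫⁻ ω, F S ω ∂(designNoise ν) ≤
      ENNReal.ofReal (δ⁻¹ ^ k * Real.exp (4 * K)) := by
    rw [← lintegral_finsetSum _ fun S _ => hFm S]
    refine (lintegral_mono (g := fun _ => ENNReal.ofReal (δ⁻¹ ^ k * Real.exp (4 * K)))
      fun ω => ?_).trans_eq (by simp)
    set J := selectedCoords γ c₀ (observe f ω) with hJ
    by_cases hJK : δ * J.card ≤ 4 * K
    · have h1 : ∀ S, F S ω = if S ∈ smallSubsets J k then 1 else 0 := fun S => by
        simp only [hF, Set.indicator, inclusionEvent, Set.mem_ofPred_eq, ← hJ, ← hδ, hJK, and_true,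
          ← hk, Pi.one_apply]
      simp only [h1]
      rw [Finset.sum_boole, Finset.filter_univ_mem, ← ENNReal.ofReal_natCast]
      refine ENNReal.ofReal_le_ofReal ((card_smallSubsets_le J k hδ0 hδ1).trans ?_)
      gcongr
    · have h1 : ∀ S, F S ω = 0 := fun S => by
        simp only [hF, Set.indicator, inclusionEvent, Set.mem_ofPred_eq, ← hJ, ← hδ, hJK, and_false,
          if_false]
      simp [h1]
  have hbad : designNoise ν Bad ≤ ENNReal.ofReal (6 * d * Real.exp (-((n / 2 : ℕ) *
      (δ / 32) ^ 2 / (2 * (1 + σ ^ 2))))) := by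
    rw [← ofReal_measureReal]
    exact ENNReal.ofReal_le_ofReal (measureReal_deviationEvent_le hν hIcc (by positivity)
      (by linarith))
  have hN0 : 0 ≤ δ⁻¹ ^ k * Real.exp (4 * K) := by positivity
  rw [risk_eq_lintegral hp (measurable_fourierEstimator γ c₀)]
  calc _ ≤ ∫⁻ ω, ((ENNReal.ofReal b + ∑ S, F S ω * G S ω) + Bad.indicator 1 ω)
        ∂(designNoise ν) := lintegral_mono hpt
    _ = (ENNReal.ofReal b + ∑ S, (∫⁻ ω, F S ω ∂(designNoise ν)) *
          ∫⁻ ω, G S ω ∂(designNoise ν)) + ∫⁻ ω, Bad.indicator 1 ω ∂(designNoise ν) := by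
        have hFGm : ∀ S, Measurable fun ω => F S ω * G S ω := fun S => (hFm S).mul (hGm S)
        have hm : Measurable fun ω => ENNReal.ofReal b + ∑ S, F S ω * G S ω :=
          measurable_const.add (Finset.measurable_fun_sum _ fun S _ => hFGm S)
        rw [lintegral_add_left hm, lintegral_add_left measurable_const,
          lintegral_finsetSum _ fun S _ => hFGm S]
        simp only [hindep, lintegral_const, measure_univ, mul_one]
    _ ≤ (ENNReal.ofReal b + ∑ S, (∫⁻ ω, F S ω ∂(designNoise ν)) * ENNReal.ofReal V) +
          designNoise ν Bad := by
        gcongr with S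
        · exact lintegral_empiricalCoeff_sub_sq_le hσ hν hn hIcc S
        · exact lintegral_indicator_one_le _
    _ ≤ (ENNReal.ofReal b + ENNReal.ofReal (δ⁻¹ ^ k * Real.exp (4 * K)) * ENNReal.ofReal V) +
          ENNReal.ofReal (6 * d * Real.exp (-((n / 2 : ℕ) *
            (δ / 32) ^ 2 / (2 * (1 + σ ^ 2))))) := by
        rw [← Finset.sum_mul]
        gcongr
    _ = _ := by
        rw [← ENNReal.ofReal_mul hN0, ← ENNReal.ofReal_add hb0 (by positivity),
          ← ENNReal.ofReal_add (by positivity) (by positivity)]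

end UpperBound

/-! ### Each error term at the chosen cut-off is `O(1/√(log n))`. -/

section Rates

/-- For `s ≥ 2c₀` the positive part is inactive and the unrounded cut-off `T` satisfies `γT² = s² -
c₀s ≥ s²/2`. Rounding up costs at most `2γT + γ ≤ 2√γ s + γ` in `γk²`. -/
lemma degreeCutoff_bounds {γ c₀ : ℝ} (hγ : 0 < γ) (hc₀ : 0 < c₀) {n : ℕ}
    (hs : 2 * c₀ ≤ Real.sqrt (Real.log n)) :
    Real.log n ≤ 2 * γ * (degreeCutoff γ c₀ n : ℝ) ^ 2 ∧
      Real.sqrt γ * degreeCutoff γ c₀ n ≤ Real.sqrt (Real.log n) + Real.sqrt γ ∧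
      γ * (degreeCutoff γ c₀ n : ℝ) ^ 2 ≤
        Real.log n - (c₀ - 2 * Real.sqrt γ) * Real.sqrt (Real.log n) + γ := by
  set s := Real.sqrt (Real.log n) with hsdef
  have hs0 : 0 < s := by linarith
  have hs2 : Real.log n = s ^ 2 := (Real.sq_sqrt (Real.sqrt_pos.mp hs0).le).symm
  set r := Real.sqrt γ with hr
  have hr0 : 0 < r := Real.sqrt_pos.mpr hγ
  have hr2 : r ^ 2 = γ := Real.sq_sqrt hγ.le
  set k := degreeCutoff γ c₀ n with hk
  set T := Real.sqrt (max (Real.log n - c₀ * s) 0 / γ) with hT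
  have hT0 : 0 ≤ T := Real.sqrt_nonneg _
  have hT2 : γ * T ^ 2 = s ^ 2 - c₀ * s := by
    rw [hT, Real.sq_sqrt (by positivity), max_eq_left (by rw [hs2]; nlinarith), hs2]
    field_simp
  have hkT : T ≤ k := by
    refine (Nat.le_ceil T).trans ?_
    exact_mod_cast le_max_left _ _
  have hkT' : (k : ℝ) ≤ T + 1 := by
    rw [hk, degreeCutoff, Nat.cast_max, Nat.cast_one]
    exact max_le (Nat.ceil_lt_add_one hT0).le (by linarith)
  have hk0 : (0 : ℝ) ≤ k := Nat.cast_nonneg _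
  have hrT : r * T ≤ s := by
    refine abs_le_of_sq_le_sq' ?_ hs0.le |>.2
    rw [mul_pow, hr2, hT2]
    nlinarith
  have hrk : r * k ≤ s + r := by nlinarith
  rw [hs2]
  refine ⟨?_, hrk, ?_⟩
  · have : γ * T ^ 2 ≤ γ * (k : ℝ) ^ 2 := by gcongr
    nlinarith
  · have : γ * (k : ℝ) ^ 2 ≤ γ * (T + 1) ^ 2 := by gcongr
    have h2 : γ * T = r * (r * T) := by rw [← hr2]; ring
    nlinarith

lemma exp_neg_le_two_div_sq {x : ℝ} (hx : 0 < x) : Real.exp (-x) ≤ 2 / x ^ 2 := by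
  rw [Real.exp_neg, inv_le_comm₀ (Real.exp_pos _) (by positivity), inv_div]
  linarith [Real.quadratic_le_exp_of_nonneg hx.le]

lemma exp_neg_le_inv {x : ℝ} (hx : 0 < x) : Real.exp (-x) ≤ 1 / x := by
  rw [Real.exp_neg, ← one_div]
  exact one_div_le_one_div_of_le hx (by linarith [Real.add_one_le_exp x])

/-- The term is `e^{-ηk} K` with `η = γ/2 - log 3 > 0`. Since `k` is at least of order `s`, a
quadratic bound on the exponential offsets `K ≤ s` with a factor `1/s` to spare. -/
lemma low_degree_term_le {γ s : ℝ} (hγ : 2 * Real.log 3 < γ) (hs : 0 < s) {k : ℕ}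
    (hk : s ^ 2 ≤ 2 * γ * (k : ℝ) ^ 2) {K : ℝ} (hK0 : 0 ≤ K) (hK : K ≤ s) :
    3 ^ k * Real.sqrt (Real.exp (-γ * k)) * K ≤ 4 * γ / (γ / 2 - Real.log 3) ^ 2 / s := by
  have hγ0 : 0 < γ := lt_trans (mul_pos two_pos (Real.log_pos (by norm_num))) hγ
  set η := γ / 2 - Real.log 3 with hη
  have hη0 : 0 < η := by rw [hη]; linarith
  have hk0 : (0 : ℝ) < k := by
    rcases Nat.eq_zero_or_pos k with h | h
    · rw [h] at hk
      norm_num at hk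
      exact absurd hk (by positivity)
    · exact_mod_cast h
  have h1 : 3 ^ k * Real.sqrt (Real.exp (-γ * k)) = Real.exp (-(η * k)) := by
    rw [Real.sqrt_eq_rpow, ← Real.exp_mul, ← Real.exp_log (show (0 : ℝ) < 3 by norm_num),
      ← Real.exp_nat_mul, ← Real.exp_add]
    congr 1
    rw [hη]; ring
  rw [h1]
  calc Real.exp (-(η * k)) * K ≤ 2 / (η * k) ^ 2 * s := by
        gcongr
        exact exp_neg_le_two_div_sq (by positivity)
    _ ≤ 4 * γ / η ^ 2 / s := by
        rw [div_mul_eq_mul_div, div_div, div_le_div_iff₀ (by positivity) (by positivity), mul_pow]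
        have := mul_le_mul_of_nonneg_left hk (show 0 ≤ 2 * η ^ 2 by positivity)
        linarith

/-- In `c₀ ≥ 2√γ + 5` the part `2√γ` pays for rounding, 4 pays for `e^{4K}` with `K ≤ s`, and 1
leaves the factor `e^{-s} ≤ 1/s`. -/
lemma variance_term_le {γ c₀ s σ : ℝ} (hc₀ : 2 * Real.sqrt γ + 5 ≤ c₀) {n : ℕ}
    (hn : 2 ≤ n) (hs : 0 < s) (hsn : Real.log n = s ^ 2) {k : ℕ}
    (hk : γ * (k : ℝ) ^ 2 ≤ s ^ 2 - (c₀ - 2 * Real.sqrt γ) * s + γ) {K : ℝ} (hK : K ≤ s) :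
    (Real.exp (-γ * k))⁻¹ ^ k * Real.exp (4 * K) * ((1 + 4 * σ ^ 2) / (n - n / 2 : ℕ)) ≤
      2 * (1 + 4 * σ ^ 2) * Real.exp γ / s := by
  have hn0 : (0 : ℝ) < n := by positivity
  have hhalf : (n : ℝ) / 2 ≤ (n - n / 2 : ℕ) := by
    rw [div_le_iff₀ two_pos]
    have : n ≤ (n - n / 2) * 2 := by omega
    exact_mod_cast this
  have hnexp : (n : ℝ) = Real.exp (s ^ 2) := by rw [← hsn, Real.exp_log hn0]
  have h1 : (Real.exp (-γ * k))⁻¹ ^ k * Real.exp (4 * K) =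
      Real.exp (γ * (k : ℝ) ^ 2 + 4 * K) := by
    rw [← Real.exp_neg, ← Real.exp_nat_mul, ← Real.exp_add]
    ring_nf
  have h2 : γ * (k : ℝ) ^ 2 + 4 * K ≤ s ^ 2 + γ + -s := by nlinarith
  rw [h1]
  calc _ ≤ Real.exp (s ^ 2 + γ + -s) * ((1 + 4 * σ ^ 2) / (n / 2)) := by gcongr
    _ = 2 * (1 + 4 * σ ^ 2) * Real.exp γ * Real.exp (-s) := by
        rw [Real.exp_add, Real.exp_add, ← hnexp]
        field_simp
    _ ≤ 2 * (1 + 4 * σ ^ 2) * Real.exp γ * (1 / s) := by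
        gcongr
        exact exp_neg_le_inv hs
    _ = _ := by ring

lemma deviation_term_le {γ s σ ε : ℝ} (hγ : 0 < γ) (hε : 0 < ε) (hε1 : ε < 1) {n d : ℕ}
    (hn : 2 ≤ n) (hd : 1 ≤ d) (hs1 : 1 / (1 - ε) ≤ s)
    (hs2 : (2 * Real.sqrt γ + 1) / ε ≤ s)
    (hs3 : 2 * γ + Real.log (12288 * (1 + σ ^ 2)) ≤ s)
    (hsn : Real.log n = s ^ 2) (hdn : Real.log d ≤ (n : ℝ) ^ (1 - ε)) {k : ℕ}
    (hk : Real.sqrt γ * k ≤ s + Real.sqrt γ) :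
    6 * d * Real.exp (-((n / 2 : ℕ) * (Real.exp (-γ * k) / 32) ^ 2 / (2 * (1 + σ ^ 2)))) ≤
      6 / s := by
  have hn0 : (0 : ℝ) < n := by positivity
  have hd0 : (0 : ℝ) < d := by exact_mod_cast hd
  have hε' : 0 < 1 - ε := by linarith
  have hs : 0 < s := lt_of_lt_of_le (by positivity) hs1
  have hthird : (n : ℝ) / 3 ≤ (n / 2 : ℕ) := by
    rw [div_le_iff₀ three_pos]
    have : n ≤ (n / 2) * 3 := by omega
    exact_mod_cast this
  have hnexp : (n : ℝ) = Real.exp (s ^ 2) := by rw [← hsn, Real.exp_log hn0]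
  set r := Real.sqrt γ with hr
  have hr2 : r ^ 2 = γ := Real.sq_sqrt hγ.le
  have hγk : γ * k ≤ r * s + γ := by
    have := mul_le_mul_of_nonneg_left hk (Real.sqrt_nonneg γ)
    rw [← hr] at this
    nlinarith
  have hA : (n : ℝ) ^ (1 - ε) = Real.exp ((1 - ε) * s ^ 2) := by
    rw [hnexp, ← Real.exp_mul]; ring_nf
  have hsA : s ≤ Real.exp ((1 - ε) * s ^ 2) := by
    have h1 : s ≤ (1 - ε) * s ^ 2 := by
      rw [div_le_iff₀ hε'] at hs1
      nlinarith
    linarith [Real.add_one_le_exp ((1 - ε) * s ^ 2)]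
  -- Of the two copies of `n^{1-ε}`, one absorbs `log d` and the other exceeds `log s`. The constant
  -- collects `12288 = 2 * 3 * 32² * 2`, the 3 coming from `⌊n/2⌋ ≥ n/3`.
  have hmain : 2 * Real.exp ((1 - ε) * s ^ 2) ≤
      (n / 2 : ℕ) * (Real.exp (-γ * k) / 32) ^ 2 / (2 * (1 + σ ^ 2)) := by
    have h1 : (1 - ε) * s ^ 2 + Real.log (12288 * (1 + σ ^ 2)) ≤ s ^ 2 + -(2 * (γ * k)) := by
      rw [div_le_iff₀ hε] at hs2
      nlinarith
    have h2 := Real.exp_le_exp.mpr h1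
    rw [Real.exp_add, Real.exp_add, Real.exp_log (by positivity), ← hnexp] at h2
    have h3 : Real.exp (-γ * k) ^ 2 = Real.exp (-(2 * (γ * k))) := by
      rw [← Real.exp_nat_mul]; push_cast; ring_nf
    rw [div_pow, h3]
    calc 2 * Real.exp ((1 - ε) * s ^ 2) = Real.exp ((1 - ε) * s ^ 2) * (12288 * (1 + σ ^ 2)) /
          (6144 * (1 + σ ^ 2)) := by field_simp; norm_num
      _ ≤ n * Real.exp (-(2 * (γ * k))) / (6144 * (1 + σ ^ 2)) := by gcongr
      _ = n / 3 * (Real.exp (-(2 * (γ * k))) / 32 ^ 2) / (2 * (1 + σ ^ 2)) := by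
          field_simp; norm_num
      _ ≤ _ := by gcongr
  have hlogs : Real.log s ≤ Real.exp ((1 - ε) * s ^ 2) :=
    (Real.log_le_self hs.le).trans hsA
  rw [hA] at hdn
  calc _ = 6 * Real.exp (Real.log d + -((n / 2 : ℕ) * (Real.exp (-γ * k) / 32) ^ 2 /
          (2 * (1 + σ ^ 2)))) := by
        rw [Real.exp_add, Real.exp_log hd0]; ring
    _ ≤ 6 * Real.exp (-Real.log s) := by
        gcongr
        linarith
    _ = 6 / s := by rw [Real.exp_neg, Real.exp_log hs]; rfl

end Rates

theorem risk_fourierEstimator_rate {γ c₀ σ ε : ℝ} (hγ : 2 * Real.log 3 < γ)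
    (hc₀ : 2 * Real.sqrt γ + 5 ≤ c₀) (hσ : 0 < σ) (hε : 0 < ε) (hε1 : ε < 1) :
    ∃ C : ℝ, 0 < C ∧ ∀ n d : ℕ, 2 ≤ n → 1 ≤ d → ∀ ν : Fin n → Measure ℝ,
      (∀ j, IsNoiseLaw σ (ν j)) → Real.log d ≤ (n : ℝ) ^ (1 - ε) →
      ∀ K B : ℝ, 1 ≤ K → K ≤ Real.sqrt (Real.log n) → 1 ≤ B →
      ∀ f ∈ influenceSubclass d K B,
        risk ν (fourierEstimator γ c₀) f ≤
          ENNReal.ofReal (C * (B / Real.sqrt (Real.log n))) := by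
  have hγ0 : 0 < γ := lt_trans (mul_pos two_pos (Real.log_pos (by norm_num))) hγ
  have hc0 : 0 < c₀ := lt_of_lt_of_le (by positivity) hc₀
  have hε' : 0 < 1 - ε := by linarith
  have hlog0 : 0 ≤ Real.log (12288 * (1 + σ ^ 2)) :=
    Real.log_nonneg (by nlinarith [sq_nonneg σ])
  -- The sum dominates every lower bound on `s` needed by the cut-off and deviation estimates.
  set s₀ := 2 * c₀ + 1 / (1 - ε) + (2 * Real.sqrt γ + 1) / ε +
    (2 * γ + Real.log (12288 * (1 + σ ^ 2))) with hs₀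
  have ha := show 0 < 1 / (1 - ε) by positivity
  have hb := show 0 < (2 * Real.sqrt γ + 1) / ε by positivity
  have hs₀0 : 0 < s₀ := by positivity
  set C₁ := Real.sqrt (2 * γ) / 4
  set C₂ := 4 * γ / (γ / 2 - Real.log 3) ^ 2
  set C₃ := 2 * (1 + 4 * σ ^ 2) * Real.exp γ
  have hC₁ : 0 ≤ C₁ := by positivity
  have hC₂ : 0 ≤ C₂ := by positivity
  have hC₃ : 0 ≤ C₃ := by positivity
  refine ⟨s₀ + (C₁ + C₂ + C₃ + 6), by positivity, ?_⟩
  intro n d hn hd ν hν hdn K B hK1 hKs hB1 f hf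
  have hn' : (2 : ℝ) ≤ n := by exact_mod_cast hn
  have hL0 : 0 < Real.log n := Real.log_pos (by linarith)
  set s := Real.sqrt (Real.log n) with hs
  have hs0 : 0 < s := Real.sqrt_pos.mpr hL0
  have hs2 : Real.log n = s ^ 2 := (Real.sq_sqrt hL0.le).symm
  have hB0 : 0 < B := by linarith
  -- For `s ≤ s₀` the trivial bound 1 on the risk suffices, as `s₀ B/s ≥ 1`. For large `s` the terms
  -- of order `1/s` are absorbed into `B/s` by `B ≥ 1`.
  rcases le_total s s₀ with hsmall | hlarge
  · refine (risk_fourierEstimator_le_one (fun j => (hν j).isProbabilityMeasure) γ c₀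
      hf.1.1.2).trans ?_
    rw [← ENNReal.ofReal_one]
    refine ENNReal.ofReal_le_ofReal ?_
    rw [← mul_div_assoc, one_le_div hs0]
    nlinarith [mul_nonneg (show 0 ≤ C₁ + C₂ + C₃ + 6 by positivity) hB0.le]
  · refine (risk_fourierEstimator_le hσ hν hn hγ0 c₀ (by linarith) hB0.le hf).trans
      (ENNReal.ofReal_le_ofReal ?_)
    obtain ⟨hk1, hk2, hk3⟩ := degreeCutoff_bounds (n := n) hγ0 hc0 (by linarith)
    rw [← hs] at hk2 hk3
    rw [hs2] at hk1 hk3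
    have hkpos : (0 : ℝ) < degreeCutoff γ c₀ n := by
      exact_mod_cast one_le_degreeCutoff γ c₀ n
    set k := degreeCutoff γ c₀ n with hk
    have t1 : B / (4 * k) ≤ C₁ * (B / s) := by
      have h1 : s ≤ Real.sqrt (2 * γ) * k := by
        refine abs_le_of_sq_le_sq' ?_ (by positivity) |>.2
        rw [mul_pow, Real.sq_sqrt (show 0 ≤ 2 * γ by positivity)]
        exact hk1
      rw [← mul_div_assoc, div_le_div_iff₀ (by positivity) hs0]
      calc B * s ≤ B * (Real.sqrt (2 * γ) * k) := by gcongr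
        _ = C₁ * B * (4 * k) := by simp only [C₁]; ring
    have t2 := low_degree_term_le hγ hs0 hk1 (by linarith) hKs
    have t3 := variance_term_le (σ := σ) hc₀ hn hs0 hs2 hk3 hKs
    have t4 := deviation_term_le (σ := σ) hγ0 hε hε1 hn hd (by linarith) (by linarith)
      (by linarith) hs2 hdn hk2
    have hBs : 1 / s ≤ B / s := by gcongr
    have e2 : C₂ / s ≤ C₂ * (B / s) := by
      rw [div_eq_mul_one_div]; gcongr
    have e3 : C₃ / s ≤ C₃ * (B / s) := by
      rw [div_eq_mul_one_div]; gcongr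
    have e4 : 6 / s ≤ 6 * (B / s) := by
      rw [div_eq_mul_one_div]; gcongr
    have e0 : 0 ≤ s₀ * (B / s) := by positivity
    unfold influenceThreshold
    rw [← hk]
    linarith

end CubeRegression

end

theorem theorem2 (γ : ℝ) (hγ : 2 * Real.log 3 < γ) :
    ∃ c₀min : ℝ, 0 < c₀min ∧ ∀ c₀ : ℝ, c₀min ≤ c₀ →
    ∀ σ : ℝ, 0 < σ → ∀ ε : ℝ, 0 < ε → ε < 1 →
    ∃ c C : ℝ, 0 < c ∧ 0 < C ∧
    ∀ n d : ℕ, 2 ≤ n → 1 ≤ d →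
    ∀ ν : Fin n → Measure ℝ, (∀ j, IsNoiseLaw σ (ν j)) →
      -- the upper bound, for the Fourier thresholding estimator
      (Real.log d ≤ (n : ℝ) ^ (1 - ε) →
        Measurable (fourierEstimator γ c₀ : Sample n d → Cube d → ℝ) ∧
        ∀ K B : ℝ, 1 ≤ K → K ≤ Real.sqrt (Real.log n) → 1 ≤ B → B ≤ K →
          (⨆ f ∈ influenceSubclass d K B, risk ν (fourierEstimator γ c₀) f)
            ≤ ENNReal.ofReal (C * (B / Real.sqrt (Real.log n)))) ∧
      -- the lower bound, over all (measurable) estimators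
      (∀ K B : ℝ, 0 < K → K ≤ c * Real.sqrt (Real.log n) →
        0 < B → B ≤ K ^ 2 / Real.sqrt (Real.log n) →
        (1 / c) * Real.log n ≤ (d : ℝ) →
          ENNReal.ofReal (c * (B / Real.log n)) ≤
            ⨅ (ftilde : Sample n d → Cube d → ℝ) (_ : Measurable ftilde),
              (⨆ f ∈ influenceSubclass d K B, risk ν ftilde f)) := by
  refine ⟨2 * Real.sqrt γ + 5, by positivity, fun c₀ hc₀ σ hσ ε hε hε1 => ?_⟩
  obtain ⟨C, hC, hupper⟩ := risk_fourierEstimator_rate hγ hc₀ hσ hε hε1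
  refine ⟨1 / 200, C, by norm_num, hC, fun n d hn hd ν hν => ⟨fun hdn =>
    ⟨measurable_fourierEstimator γ c₀, fun K B hK hKn hB _ => iSup₂_le fun f hf =>
      hupper n d hn hd ν hν hdn K B hK hKn hB f hf⟩, fun K B hK hKn hB hBK hdn => ?_⟩⟩
  have hL : 0 ≤ Real.log n := Real.log_natCast_nonneg n
  have hs := Real.sqrt_nonneg (Real.log n)
  exact minimax_lower_bound (fun j => (hν j).isProbabilityMeasure) hn hK (by linarith) hB hBK
    (by linarith)
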